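/- Let $\mathbb K$ be a commutative ring. For a $\mathbb K$-module $V$ and $n\ge 0$ let $\mathscr F_n(V)=V^{\otimes n}\otimes\mathbb K\mathfrak S_n$ (write $t\#\sigma$ for $t\otimes\sigma$) and $\mathscr F(V)=\bigoplus_{n\ge0}\mathscr F_n(V)$; here $\mathscr F_0(V)=\mathbb K$. The group $\mathfrak S_n$ acts on $V^{\otimes n}$ by $\pi\cdot(v_1\otimes\cdots\otimes v_n)=v_{\pi^{-1}(1)}\otimes\cdots\otimes v_{\pi^{-1}(n)}$ and on $\mathscr F_n(V)$ by $\pi\cdot(t\#\sigma)=(\pi\cdot t)\#(\pi\sigma)$; let $e_n$ be the unit of $\mathfrak S_n$ and $\mathrm{TS}^n(V)$ the module of $\mathfrak S_n$-invariant (symmetric) tensors in $V^{\otimes n}$. The external product on $\mathscr F(V)$ is the bilinear map with $$(t\#\sigma)*(t'\#\sigma')=\sum_{\rho}\rho\cdot\bigl[(t\otimes t')\#(\sigma\times\sigma')\bigr]\qquad(t\in V^{\otimes n},\ \sigma\in\mathfrak S_n,\ t'\in V^{\otimes n'},\ \sigma'\in\mathfrak S_{n'}),$$ where $\rho$ runs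 over the permutations in $\mathfrak S_{n+n'}$ that are increasing on $\{1,\dots,n\}$ and on $\{n+1,\dots,n+n'\}$, and $\sigma\times\sigma'$ acts as $\sigma$ on the first $n$ letters and as $\sigma'$, shifted by $n$, on the last $n'$ letters. Its unit is $1\in\mathscr F_0(V)=\mathbb K$. The coproduct is the linear map with $$\Delta\bigl((v_1\otimes\cdots\otimes v_n)\#\sigma\bigr)=\sum_{p=0}^n\bigl[(v_1\otimes\cdots\otimes v_p)\#\pi_p\bigr]\otimes\bigl[(v_{p+1}\otimes\cdots\otimes v_n)\#\pi'_{n-p}\bigr],$$ where $\pi_p\in\mathfrak S_p$ and $\pi'_{n-p}\in\mathfrak S_{n-p}$ are the inverses of the standardizations of the words $\sigma^{-1}(1)\cdots\sigma^{-1}(p)$ and $\sigma^{-1}(p+1)\cdots\sigma^{-1}(n)$ (the standardization of a word $a_1\cdots a_m$ is the permutation $\tau\in\mathfrak S_m$ with the fewest inversions such that $a_{\tau^{-1}(1)},\dots,a_{\tau^{-1}(m)}$ is non-decreasing). The counit is the projection onto $\mathscr F_0(V)=\mathbb K$. The iterated coproducts $\Delta_l:\mathscr F(V)\to\mathscr F(V)^{\otimes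 l}$ are $\Delta_0=$ the counit, $\Delta_1=\mathrm{id}$ and $\Delta_{l+1}=(\Delta_l\otimes\mathrm{id})\circ\Delta$ for $l\ge1$; one writes $\Delta_l(y)=\sum_{(y)}y_{(1)}\otimes\cdots\otimes y_{(l)}$. Let $\mathrm{NT}(V)$ be the unital subalgebra of $(\mathscr F(V),*)$ generated by all $t\#e_n$ with $n\ge0$ and $t\in\mathrm{TS}^n(V)$. For an associative unital $\mathbb K$-algebra $A$, the internal product on $\mathscr F(A)$ is the bilinear map with $(a\#\sigma)\cdot(b\#\tau)=\bigl(a\,(\sigma\cdot b)\bigr)\#(\sigma\tau)$ for $a,b\in A^{\otimes n}$ and $\sigma,\tau\in\mathfrak S_n$, where $a\,(\sigma\cdot b)$ is the product in the algebra $A^{\otimes n}$, and with $\alpha\cdot\beta=0$ for $\alpha\in\mathscr F_n(A)$, $\beta\in\mathscr F_m(A)$, $n\ne m$. **Theorem (splitting formula).** Let $A$ be an associative unital $\mathbb K$-algebra whose underlying $\mathbb K$-module is projective, let $l\ge0$, let $y\in\mathrm{NT}(A)$ and $z_1,\dots,z_l\in\mathscr F(A)$. Then $$y\cdot(z_1*z_2*\cdots*z_l)=\sum_{(y)}(y_{(1)}\cdot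 z_1)*(y_{(2)}\cdot z_2)*\cdots*(y_{(l)}\cdot z_l).$$ (For $l=0$ the empty external product is the unit, and the right-hand side is the counit of $y$ times the unit.) -/

import Mathlib

open scoped TensorProduct DirectSum

noncomputable section

namespace FreeQuasiSym

/-! ### Permutations -/

/-- The permutation `σ × τ` of `{1, …, n + m}`: `σ` on the first `n` letters and `τ`, shifted
by `n`, on the last `m` letters. -/
def crossPerm {n m : ℕ} (σ : Equiv.Perm (Fin n)) (τ : Equiv.Perm (Fin m)) :
    Equiv.Perm (Fin (n + m)) :=
  finSumFinEquiv.permCongr (Equiv.Perm.sumCongr σ τ)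

open Classical in
/-- The set `X_(n,m)` of the permutations of `{1, …, n + m}` that are increasing on the first `n`
and on the last `m` letters. -/
def shuffles (n m : ℕ) : Finset (Equiv.Perm (Fin (n + m))) :=
  Finset.univ.filter fun ρ =>
    StrictMono (fun i : Fin n => ρ (Fin.castAdd m i)) ∧
      StrictMono (fun j : Fin m => ρ (Fin.natAdd n j))

/-- The standardization of a word `w` of length `n` in a totally ordered alphabet.
`Tuple.sort w` is the stable sorting permutation: `w ∘ Tuple.sort w` is non-decreasing and equal
letters keep their order, so that `σ = (Tuple.sort w)⁻¹` is the permutation with the fewest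
inversions such that `w ∘ σ⁻¹` is non-decreasing. -/
def standardization {n : ℕ} {α : Type*} [LinearOrder α] (w : Fin n → α) :
    Equiv.Perm (Fin n) :=
  (Tuple.sort w)⁻¹

section Module

variable (K : Type*) [CommRing K] (V : Type*) [AddCommGroup V] [Module K V]

/-! ### The graded module `F(V)` -/

/-- The homogeneous component `F_n(V) = V^{⊗ n} # K S_n`. -/
abbrev Comp (n : ℕ) : Type _ :=
  (⨂[K]^n V) ⊗[K] MonoidAlgebra K (Equiv.Perm (Fin n))

/-- The graded module `F(V) = ⨁ n, F_n(V)`. -/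
abbrev FQ : Type _ := ⨁ n : ℕ, Comp K V n

variable {V}

/-- The map `t ↦ t # σ` from `V^{⊗ n}` to `F_n(V)`. -/
def sharp {n : ℕ} (σ : Equiv.Perm (Fin n)) : (⨂[K]^n V) →ₗ[K] Comp K V n :=
  (TensorProduct.mk K (⨂[K]^n V) (MonoidAlgebra K (Equiv.Perm (Fin n)))).flip
    (MonoidAlgebra.single σ 1)

/-- The linear map on `F_n(V)` that sends `t # σ` to `f σ t`. -/
def liftComp {n : ℕ} {M : Type*} [AddCommMonoid M] [Module K M]
    (f : Equiv.Perm (Fin n) → (⨂[K]^n V) →ₗ[K] M) : Comp K V n →ₗ[K] M :=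
  TensorProduct.lift
    (Finsupp.linearCombination K f ∘ₗ
      (MonoidAlgebra.coeffLinearEquiv K).toLinearMap).flip

/-- The action of the symmetric group on `V^{⊗ n}` by permutation of places:
`π · (v₁ ⊗ ⋯ ⊗ vₙ) = v_{π⁻¹(1)} ⊗ ⋯ ⊗ v_{π⁻¹(n)}`. -/
def permTensor {n : ℕ} (π : Equiv.Perm (Fin n)) : (⨂[K]^n V) →ₗ[K] (⨂[K]^n V) :=
  (PiTensorProduct.reindex K (fun _ : Fin n => V) π).toLinearMap

/-- The left action of the symmetric group on `F_n(V)`: `π · (t # σ) = (π · t) # (π σ)`. -/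
def permAct {n : ℕ} (π : Equiv.Perm (Fin n)) : Comp K V n →ₗ[K] Comp K V n :=
  liftComp K fun σ => sharp K (π * σ) ∘ₗ permTensor K π

/-! ### The external product -/

/-- Concatenation of tensors `V^{⊗ n} × V^{⊗ m} → V^{⊗ (n + m)}`. -/
def concat (n m : ℕ) : (⨂[K]^n V) →ₗ[K] (⨂[K]^m V) →ₗ[K] (⨂[K]^(n + m) V) :=
  (TensorProduct.mk K (⨂[K]^n V) (⨂[K]^m V)).compr₂ TensorPower.mulEquiv.toLinearMap

/-- The external product on homogeneous components:
`(t # σ) * (t' # σ') = x_(n,m) · ((t ⊗ t') # (σ × σ'))`, where `x_(n,m)` is the sum of the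
elements of `X_(n,m)`. -/
def extMulComp (n m : ℕ) : Comp K V n →ₗ[K] Comp K V m →ₗ[K] Comp K V (n + m) :=
  liftComp K fun σ => LinearMap.flip (liftComp K fun τ => LinearMap.flip
    ((concat K n m).compr₂ ((∑ ρ ∈ shuffles n m, permAct K ρ) ∘ₗ sharp K (crossPerm σ τ))))

/-- The external product `*` of `F(V)`. -/
def extMul : FQ K V →ₗ[K] FQ K V →ₗ[K] FQ K V :=
  DirectSum.toModule K ℕ _ fun n => LinearMap.flip <|
    DirectSum.toModule K ℕ _ fun m => LinearMap.flip <|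
      (extMulComp K n m).compr₂ (DirectSum.lof K ℕ (Comp K V) (n + m))

variable (V) in
/-- The unit of `F(V)`: the element `1` of `F_0(V) = K`. -/
def unit : FQ K V :=
  DirectSum.lof K ℕ (Comp K V) 0 (sharp K 1 (PiTensorProduct.tprod K fun i => i.elim0))

variable (V) in
/-- The iterated external product `(z₁, …, z_l) ↦ z₁ * (z₂ * (⋯ * z_l))`; for `l = 0` it is the
unit. -/
def extProd : (l : ℕ) → MultilinearMap K (fun _ : Fin l => FQ K V) (FQ K V)
  | 0 => MultilinearMap.constOfIsEmpty K _ (unit K V)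
  | l + 1 => LinearMap.uncurryLeft (M := fun _ : Fin (l + 1) => FQ K V)
      { toFun := fun x => (extMul K x).compMultilinearMap (extProd l)
        map_add' := fun x y => by ext z; simp
        map_smul' := fun c x => by ext z; simp }

/-! ### The coproduct -/

/-- The identification `V^{⊗ n} = V^{⊗ p} ⊗ V^{⊗ q}` for `p + q = n`. -/
def split {n p q : ℕ} (h : p + q = n) : (⨂[K]^n V) →ₗ[K] (⨂[K]^p V) ⊗[K] (⨂[K]^q V) :=
  TensorPower.mulEquiv.symm.toLinearMap ∘ₗ (TensorPower.cast K V h.symm).toLinearMap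

/-- The inverse of the standardization of the word `σ⁻¹(1) ⋯ σ⁻¹(p)`, where `p + q = n`. -/
def leftPart {n p q : ℕ} (h : p + q = n) (σ : Equiv.Perm (Fin n)) : Equiv.Perm (Fin p) :=
  (standardization fun i : Fin p => σ⁻¹ (Fin.cast h (Fin.castAdd q i)))⁻¹

/-- The inverse of the standardization of the word `σ⁻¹(p + 1) ⋯ σ⁻¹(n)`, where `p + q = n`. -/
def rightPart {n p q : ℕ} (h : p + q = n) (σ : Equiv.Perm (Fin n)) : Equiv.Perm (Fin q) :=
  (standardization fun j : Fin q => σ⁻¹ (Fin.cast h (Fin.natAdd p j)))⁻¹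

/-- The component `F_n(V) → F_p(V) ⊗ F_q(V)` of the coproduct, where `p + q = n`. -/
def coprodComp {n p q : ℕ} (h : p + q = n) : Comp K V n →ₗ[K] Comp K V p ⊗[K] Comp K V q :=
  liftComp K fun σ =>
    TensorProduct.map (sharp K (leftPart h σ)) (sharp K (rightPart h σ)) ∘ₗ split K h

variable (V) in
/-- The coproduct `Δ` of `F(V)`. -/
def coprod : FQ K V →ₗ[K] FQ K V ⊗[K] FQ K V :=
  DirectSum.toModule K ℕ _ fun n => ∑ pq : {pq : ℕ × ℕ // pq ∈ Finset.HasAntidiagonal.antidiagonal n},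
    TensorProduct.map (DirectSum.lof K ℕ (Comp K V) pq.1.1) (DirectSum.lof K ℕ (Comp K V) pq.1.2) ∘ₗ
      coprodComp K (Finset.HasAntidiagonal.mem_antidiagonal.1 pq.2)

variable (V) in
/-- The counit of `F(V)`: the projection onto `F_0(V) = K`. -/
def counit : FQ K V →ₗ[K] K :=
  (liftComp K fun _ => (PiTensorProduct.isEmptyEquiv (Fin 0)).toLinearMap) ∘ₗ
    DirectSum.component K ℕ (Comp K V) 0

variable (V) in
/-- The iterated coproducts `Δ_l : F(V) → F(V)^{⊗ l}`: `Δ_0` is the counit, `Δ_1` is the identity,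
and `Δ_{l+1} = (Δ_l ⊗ id) ∘ Δ` for `l ≥ 1`. -/
def iterCoprod : (l : ℕ) → FQ K V →ₗ[K] ⨂[K]^l (FQ K V)
  | 0 => (PiTensorProduct.isEmptyEquiv (Fin 0)).symm.toLinearMap ∘ₗ counit K V
  | 1 => (PiTensorProduct.subsingletonEquiv (R := K) (s := fun _ : Fin 1 => FQ K V) 0).symm.toLinearMap
  | l + 2 => (TensorPower.mulEquiv (n := l + 1) (m := 1)).toLinearMap ∘ₗ
      TensorProduct.map (iterCoprod (l + 1))
        (PiTensorProduct.subsingletonEquiv (R := K) (s := fun _ : Fin 1 => FQ K V) 0).symm.toLinearMap ∘ₗ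
      coprod K V

/-! ### The Novelli-Thibon bialgebra -/

variable (V) in
/-- The module `TS^n(V)` of symmetric tensors of degree `n`. -/
def symTensors (n : ℕ) : Submodule K (⨂[K]^n V) where
  carrier := {t | ∀ π : Equiv.Perm (Fin n), permTensor K π t = t}
  add_mem' hs ht π := by rw [map_add, hs π, ht π]
  zero_mem' π := map_zero _
  smul_mem' c t ht π := by rw [map_smul, ht π]

variable (V) in
/-- The Novelli-Thibon bialgebra `NT(V)`, as a submodule of `F(V)`: the (unital) subalgebra for
the external product generated by the elements `t # e_n` with `t` a symmetric tensor of
degree `n`. -/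
def NT : Submodule K (FQ K V) :=
  sInf {S | unit K V ∈ S ∧
    (∀ (n : ℕ), ∀ t ∈ symTensors K V n, DirectSum.lof K ℕ (Comp K V) n (sharp K 1 t) ∈ S) ∧
    ∀ x ∈ S, ∀ y ∈ S, extMul K x y ∈ S}

end Module

section Algebra

variable (K : Type*) [CommRing K] {A : Type*} [Ring A] [Algebra K A]

/-! ### The internal product -/

/-- The product of the twisted group ring `F_n(A)`: `(a # σ) · (b # τ) = (a (σ · b)) # (σ τ)`,
where the product `a (σ · b)` is that of the algebra `A^{⊗ n}`. -/
def intMulComp (n : ℕ) : Comp K A n →ₗ[K] Comp K A n →ₗ[K] Comp K A n :=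
  liftComp K fun σ => LinearMap.flip <| liftComp K fun τ => LinearMap.flip <|
    ((LinearMap.mul K (⨂[K]^n A)).compl₂ (permTensor K σ)).compr₂ (sharp K (σ * τ))

variable (A) in
/-- The internal product of `F(A)`: `α · α' = ∑ n, α_n · α'_n`. -/
def intMul : FQ K A →ₗ[K] FQ K A →ₗ[K] FQ K A :=
  DirectSum.toModule K ℕ _ fun n =>
    ((intMulComp K n).compr₂ (DirectSum.lof K ℕ (Comp K A) n)).compl₂
      (DirectSum.component K ℕ (Comp K A) n)

/-- The linear map `F(A)^{⊗ l} → F(A)` that sends `u₁ ⊗ ⋯ ⊗ u_l` to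
`(u₁ · z₁) * ⋯ * (u_l · z_l)`. Its value at `Δ_l(y)` is the Sweedler sum
`∑_(y) (y_(1) · z₁) * ⋯ * (y_(l) · z_l)`. -/
def splitMap {l : ℕ} (z : Fin l → FQ K A) : (⨂[K]^l (FQ K A)) →ₗ[K] FQ K A :=
  PiTensorProduct.lift ((extProd K A l).compLinearMap fun i => (intMul K A).flip (z i))

end Algebra

end FreeQuasiSym

end

/-! Encode `a # σ` by a word of biletters `(a_i, k_i)` in which the word of the `k_i` standardizes
to `σ⁻¹`. Only the relative order of the `k_i` matters, so in a product the letters of each factor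
may be taken larger than those of the preceding ones. Then the external product is the sum of the
shuffles of the two words, and the coproduct cuts a word in two. Associativity of `*` and
multiplicativity of `Δ` (`coprod_extMul`) thus reduce to identities about shuffling and cutting
lists.

For an `A`-module `M`, let `F(A)` act on the sum of the tensor powers of `M`, which carries the
commutative shuffle product `⧢`. An external product acts by convolution (`act_extMul`): cut the
tensor, act on both pieces, shuffle the results. Call `x` splitting if `x·(u ⧢ v) = ∑ (x₍₁₎·u) ⧢
(x₍₂₎·v)`. The element `t # e_n` with `t` symmetric is splitting because multiplication by `t`
commutes with permutations of places. Splitting elements are closed under `*`, since shuffling is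
compatible with cutting and `⧢` is commutative (`IsSplitting.mul`). Hence every element of `NT(A)`
is splitting.

Take `M = ℕ →₀ A`, the free `A`-module on the letters. Biletters are elements of `M`, and
standardizing words turns the action into the internal product and `⧢`, for ordered alphabets, into
`*`. This gives the formula for two factors (`IsSplitting.intMul_extMul`).

More factors follow by induction, provided that the left factors of `Δ(y)` can be chosen in `NT(A)`.
Flatness ensures this: symmetric tensors are the kernel of a linear map, and this kernel commutes
with tensoring by a flat module (`split_mem_range`). -/

noncomputable section

namespace FreeQuasiSym

/-! ### Sums over list shuffles and list deconcatenations -/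

section Lists

variable {X Y N : Type*} [AddCommMonoid N]

/-- The sum of `f w` over all shuffles `w` of the lists `u` and `v`. -/
def shufSum : List X → List X → (List X → N) → N
  | [], v, f => f v
  | a :: u, [], f => f (a :: u)
  | a :: u, b :: v, f =>
      shufSum u (b :: v) (fun w => f (a :: w)) + shufSum (a :: u) v (fun w => f (b :: w))
termination_by u v => u.length + v.length

/-- The sum of `g w₁ w₂` over all factorizations `w = w₁ ++ w₂`. -/
def deconSum : List X → (List X → List X → N) → N
  | [], g => g [] []
  | a :: w, g => g [] (a :: w) + deconSum w (fun x y => g (a :: x) y)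

@[simp] theorem shufSum_nil_left (v : List X) (f : List X → N) : shufSum [] v f = f v := by
  rw [shufSum]

@[simp] theorem shufSum_nil_right (u : List X) (f : List X → N) : shufSum u [] f = f u := by
  cases u <;> rw [shufSum]

theorem shufSum_cons_cons (a b : X) (u v : List X) (f : List X → N) :
    shufSum (a :: u) (b :: v) f =
      shufSum u (b :: v) (fun w => f (a :: w)) + shufSum (a :: u) v (fun w => f (b :: w)) := by
  rw [shufSum]

/-- Restricting the hypothesis to rearrangements of `u ++ v` makes distinctness and bounds of
letters available for each shuffle. -/
theorem shufSum_congr {u v : List X} {f g : List X → N}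
    (h : ∀ w, w.Perm (u ++ v) → f w = g w) : shufSum u v f = shufSum u v g := by
  fun_induction shufSum u v f generalizing g with
  | case1 v f => simpa using h v (by simp)
  | case2 a u f => simpa using h (a :: u) (by simp)
  | case3 a u b v f ih1 ih2 =>
    rw [shufSum_cons_cons]
    congr 1
    · exact ih1 fun w hw => h _ (by simpa using hw)
    · exact ih2 fun w hw => h _
        ((List.Perm.cons b hw).trans (List.perm_middle (l₁ := a :: u)).symm)

theorem map_shufSum {N' : Type*} [AddCommMonoid N'] {H : Type*} [FunLike H N N']
    [AddMonoidHomClass H N N'] (φ : H) (u v : List X) (f : List X → N) :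
    φ (shufSum u v f) = shufSum u v fun w => φ (f w) := by
  fun_induction shufSum u v f with
  | case1 v f => simp
  | case2 a u f => simp
  | case3 a u b v f ih1 ih2 => rw [shufSum_cons_cons, map_add, ih1, ih2]

theorem shufSum_add (u v : List X) (f g : List X → N) :
    shufSum u v (fun w => f w + g w) = shufSum u v f + shufSum u v g := by
  fun_induction shufSum u v f generalizing g with
  | case1 v f => simp
  | case2 a u f => simp
  | case3 a u b v f ih1 ih2 =>
    rw [shufSum_cons_cons, shufSum_cons_cons a b u v g, ih1, ih2]
    abel

theorem shufSum_map (h : X → Y) (u v : List X) (f : List Y → N) :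
    shufSum (u.map h) (v.map h) f = shufSum u v fun w => f (w.map h) := by
  induction u generalizing v f with
  | nil => simp
  | cons a u ihu =>
    induction v generalizing f with
    | nil => simp
    | cons b v ihv =>
      have h1 := ihu (b :: v) fun w => f (h a :: w)
      have h2 := ihv fun w => f (h b :: w)
      simp only [List.map_cons] at h1 h2 ⊢
      rw [shufSum_cons_cons, shufSum_cons_cons, h1, h2]
      rfl

theorem shufSum_comm (u v : List X) (f : List X → N) : shufSum u v f = shufSum v u f := by
  fun_induction shufSum u v f with
  | case1 v f => simp
  | case2 a u f => simp
  | case3 a u b v f ih1 ih2 => rw [shufSum_cons_cons, ih1, ih2, add_comm]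

/-- Sort the shuffles of three words by first letter. Those beginning with `c` arise from both
halves of the left side; they recombine through `e3`, whose left side is expanded for that purpose.
-/
theorem shufSum_assoc (u v w : List X) (f : List X → N) :
    (shufSum u v fun x => shufSum x w f) = shufSum v w fun y => shufSum u y f := by
  induction hk : u.length + v.length + w.length using Nat.strong_induction_on
    generalizing u v w f with
  | _ k ih =>
    subst hk
    rcases u with _ | ⟨a, u⟩
    · simp
    rcases v with _ | ⟨b, v⟩
    · simp
    rcases w with _ | ⟨c, w⟩
    · simp
    have e1 := ih _ (by simp) u (b :: v) (c :: w) (fun x => f (a :: x)) rfl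
    have e2 := ih _ (by simp) (a :: u) v (c :: w) (fun x => f (b :: x)) rfl
    have e3 := ih _ (by simp) (a :: u) (b :: v) w (fun x => f (c :: x)) rfl
    rw [shufSum_cons_cons] at e3 ⊢
    rw [shufSum_cons_cons b c]
    simp only [shufSum_cons_cons, shufSum_add] at e1 e2 e3 ⊢
    rw [e1, e2, add_add_add_comm, e3]
    abel

theorem deconSum_congr {w : List X} {f g : List X → List X → N}
    (h : ∀ x y, x ++ y = w → f x y = g x y) : deconSum w f = deconSum w g := by
  induction w generalizing f g with
  | nil => exact h _ _ rfl
  | cons a w ih =>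
    rw [deconSum, deconSum, h _ _ rfl, ih fun x y hxy => h _ _ (by simpa using hxy)]

theorem map_deconSum {N' : Type*} [AddCommMonoid N'] {H : Type*} [FunLike H N N']
    [AddMonoidHomClass H N N'] (φ : H) (w : List X) (f : List X → List X → N) :
    φ (deconSum w f) = deconSum w fun x y => φ (f x y) := by
  induction w generalizing f with
  | nil => rfl
  | cons a w ih => rw [deconSum, deconSum, map_add, ih]

theorem deconSum_add (w : List X) (f g : List X → List X → N) :
    deconSum w (fun x y => f x y + g x y) = deconSum w f + deconSum w g := by
  induction w generalizing f g with
  | nil => rfl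
  | cons a w ih => rw [deconSum, deconSum, deconSum, ih]; abel

theorem deconSum_zero (w : List X) : deconSum w (fun _ _ => (0 : N)) = 0 := by
  induction w with
  | nil => rfl
  | cons a w ih => rw [deconSum, ih, add_zero]

/-- Shuffling is compatible with deconcatenation. -/
theorem shufSum_deconSum (u v : List X) (g : List X → List X → N) :
    (shufSum u v fun w => deconSum w g) =
      deconSum u fun u₁ u₂ => deconSum v fun v₁ v₂ =>
        shufSum u₁ v₁ fun x => shufSum u₂ v₂ fun y => g x y := by
  induction hk : u.length + v.length using Nat.strong_induction_on generalizing u v g with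
  | _ k ih =>
    subst hk
    rcases u with _ | ⟨a, u⟩
    · simp [deconSum]
    rcases v with _ | ⟨b, v⟩
    · simp [deconSum]
    -- A nonempty left factor of a shuffle begins with `a` or with `b`; these are the two induction
    -- hypotheses. The cut with empty left factor is expanded directly.
    have e1 := ih _ (by simp) u (b :: v) (fun x y => g (a :: x) y) rfl
    have e2 := ih _ (by simp) (a :: u) v (fun x y => g (b :: x) y) rfl
    rw [shufSum_cons_cons]
    simp only [deconSum, shufSum_add, e1, e2, shufSum_nil_left, shufSum_nil_right,
      shufSum_cons_cons, deconSum_add]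
    abel

theorem deconSum_eq_sum_antidiagonal (w : List X) (g : List X → List X → N) :
    deconSum w g =
      ∑ pq ∈ Finset.HasAntidiagonal.antidiagonal w.length, g (w.take pq.1) (w.drop pq.1) := by
  induction w generalizing g with
  | nil => simp [deconSum]
  | cons a w ih => simp [deconSum, ih, Finset.Nat.sum_antidiagonal_succ]

/-- The index set and the casts are those of `coprod`, so that the two sums can be compared term by
term. -/
theorem deconSum_ofFn {n : ℕ} (f : Fin n → X) (g : List X → List X → N) :
    deconSum (List.ofFn f) g =
      ∑ pq : {pq : ℕ × ℕ // pq ∈ Finset.HasAntidiagonal.antidiagonal n},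
        g (List.ofFn fun i : Fin pq.1.1 => f (Fin.cast
            (Finset.HasAntidiagonal.mem_antidiagonal.1 pq.2) (Fin.castAdd pq.1.2 i)))
          (List.ofFn fun j : Fin pq.1.2 => f (Fin.cast
            (Finset.HasAntidiagonal.mem_antidiagonal.1 pq.2) (Fin.natAdd pq.1.1 j))) := by
  rw [deconSum_eq_sum_antidiagonal, List.length_ofFn, ← Finset.sum_attach]
  refine Finset.sum_congr rfl fun pq _ => ?_
  have h := Finset.HasAntidiagonal.mem_antidiagonal.1 pq.2
  congr 1
  · refine List.ext_getElem (by simp; omega) fun i h1 h2 => ?_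
    simp
  · refine List.ext_getElem (by simp; omega) fun i h1 h2 => ?_
    simp

/-- When a predicate separates the letters of `u` from those of `v`, the shuffles of `u` and `v`
are pairwise distinct, and they are the words whose two subwords are `u` and `v`. -/
theorem exists_finset_shufSum (p : X → Bool) (u v : List X) (hu : ∀ x ∈ u, p x = true)
    (hv : ∀ x ∈ v, p x = false) :
    ∃ T : Finset (List X), (∀ w, w ∈ T ↔ w.filter p = u ∧ w.filter (fun x => !p x) = v) ∧
      ∀ f : List X → N, shufSum u v f = ∑ w ∈ T, f w := by
  classical
  induction hk : u.length + v.length using Nat.strong_induction_on generalizing u v with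
  | _ k ih =>
    subst hk
    rcases u with _ | ⟨a, u⟩
    · refine ⟨{v}, fun w => ?_, fun f => by simp⟩
      simp only [Finset.mem_singleton]
      constructor
      · rintro rfl
        exact ⟨by simpa using hv, List.filter_eq_self.2 (by simpa using hv)⟩
      · rintro ⟨h1, h2⟩
        rw [← h2, eq_comm, List.filter_eq_self]
        simpa using h1
    rcases v with _ | ⟨b, v⟩
    · refine ⟨{a :: u}, fun w => ?_, fun f => by simp⟩
      simp only [Finset.mem_singleton]
      constructor
      · rintro rfl
        exact ⟨List.filter_eq_self.2 hu, by simpa using hu⟩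
      · rintro ⟨h1, h2⟩
        rw [← h1, eq_comm, List.filter_eq_self]
        simpa using h2
    obtain ⟨T₁, hT₁, hf₁⟩ := ih _ (by simp) u (b :: v) (fun x hx => hu x (by simp [hx])) hv rfl
    obtain ⟨T₂, hT₂, hf₂⟩ := ih _ (by simp) (a :: u) v hu (fun x hx => hv x (by simp [hx])) rfl
    have ha : p a = true := hu a (by simp)
    have hb : p b = false := hv b (by simp)
    have hab : a ≠ b := by rintro rfl; simp [ha] at hb
    refine ⟨T₁.image (List.cons a) ∪ T₂.image (List.cons b), fun w => ?_, fun f => ?_⟩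
    · simp only [Finset.mem_union, Finset.mem_image, hT₁, hT₂]
      constructor
      · rintro (⟨w, ⟨h1, h2⟩, rfl⟩ | ⟨w, ⟨h1, h2⟩, rfl⟩)
        · simp [ha, h1, h2]
        · simp [hb, h1, h2]
      · rintro ⟨h1, h2⟩
        rcases w with _ | ⟨c, w⟩
        · simp at h1
        · cases hc : p c
          · simp only [List.filter_cons, hc, Bool.not_false, if_true] at h1 h2
            obtain ⟨rfl, h3⟩ := List.cons.inj h2
            exact Or.inr ⟨w, ⟨by simpa using h1, h3⟩, rfl⟩
          · simp only [List.filter_cons, hc, Bool.not_true, if_true] at h1 h2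
            obtain ⟨rfl, h3⟩ := List.cons.inj h1
            exact Or.inl ⟨w, ⟨h3, by simpa using h2⟩, rfl⟩
    · rw [shufSum_cons_cons, hf₁, hf₂, Finset.sum_union, Finset.sum_image, Finset.sum_image]
      · intro x _ y _ h; simpa using h
      · intro x _ y _ h; simpa using h
      · rw [Finset.disjoint_left]
        intro w h1 h2
        simp only [Finset.mem_image] at h1 h2
        obtain ⟨x, _, rfl⟩ := h1
        obtain ⟨y, _, h⟩ := h2
        exact hab (List.cons.inj h).1.symm

end Lists

/-! ### Shuffle permutations and shuffles of words -/

section Shuffles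

theorem mem_shuffles {n m : ℕ} (ρ : Equiv.Perm (Fin (n + m))) :
    ρ ∈ shuffles n m ↔ StrictMono (fun i : Fin n => ρ (Fin.castAdd m i)) ∧
      StrictMono (fun j : Fin m => ρ (Fin.natAdd n j)) := by
  simp [shuffles]

/-- A word in the letters `0, …, k - 1`, each used once, is increasing on the letters of a set `p`
if and only if the subword of these letters is the increasing one. -/
theorem filter_ofFn_perm_eq_iff {k : ℕ} (ρ : Equiv.Perm (Fin k)) (p : Fin k → Bool) :
    (List.ofFn ⇑ρ⁻¹).filter p = (List.finRange k).filter p ↔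
      ∀ a b, p a = true → p b = true → a < b → ρ a < ρ b := by
  have hperm : (List.ofFn ⇑ρ⁻¹).Perm (List.finRange k) := by
    have := (ρ⁻¹).ofFn_comp_perm (id : Fin k → Fin k)
    simpa [List.ofFn_id] using this
  have hs : ((List.finRange k).filter p).Pairwise (· < ·) :=
    (List.pairwise_lt_finRange k).filter _
  -- The letter `a` stands at position `ρ a` in the word of `ρ⁻¹`.
  have key : ((List.ofFn ⇑ρ⁻¹).filter p).Pairwise (· < ·) ↔
      ∀ a b, p a = true → p b = true → a < b → ρ a < ρ b := by
    rw [List.pairwise_filter, List.pairwise_ofFn]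
    constructor
    · intro h a b ha hb hab
      by_contra hlt
      have hne : ρ b ≠ ρ a := fun h => hab.ne' (ρ.injective h)
      have := h (lt_of_le_of_ne (not_lt.1 hlt) hne)
      simp only [Equiv.Perm.inv_def, Equiv.symm_apply_apply] at this
      exact absurd (this hb ha) hab.not_gt
    · intro h i j hij hi hj
      by_contra hlt
      have hne : ρ⁻¹ j ≠ ρ⁻¹ i := fun h => hij.ne' (ρ⁻¹.injective h)
      have := h _ _ hj hi (lt_of_le_of_ne (not_lt.1 hlt) hne)
      simp only [Equiv.Perm.inv_def, Equiv.apply_symm_apply] at this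
      exact absurd hij this.not_gt
  rw [← key]
  constructor
  · intro h
    rw [h]
    exact hs
  · intro h
    exact (hperm.filter p).eq_of_pairwise (fun a b _ _ h1 h2 => absurd h1 h2.not_gt) h hs

theorem filter_finRange_add_left (n m : ℕ) :
    (List.finRange (n + m)).filter (fun x => decide (x.val < n)) =
      (List.finRange n).map (Fin.castAdd m) := by
  rw [← List.ofFn_id, List.ofFn_add, List.filter_append]
  rw [List.filter_eq_self.2, List.filter_eq_nil_iff.2]
  · simp [List.ofFn_eq_map]
    exact fun _ => rfl
  · simp [List.mem_ofFn]
  · simp [List.mem_ofFn]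

theorem filter_finRange_add_right (n m : ℕ) :
    (List.finRange (n + m)).filter (fun x => !decide (x.val < n)) =
      (List.finRange m).map (Fin.natAdd n) := by
  rw [← List.ofFn_id, List.ofFn_add, List.filter_append]
  rw [List.filter_eq_nil_iff.2, List.filter_eq_self.2]
  · simp [List.ofFn_eq_map]
  · simp [List.mem_ofFn]
  · simp [List.mem_ofFn]

theorem mem_shuffles_iff_filter {n m : ℕ} (ρ : Equiv.Perm (Fin (n + m))) :
    ρ ∈ shuffles n m ↔
      (List.ofFn ⇑ρ⁻¹).filter (fun x => decide (x.val < n)) =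
          (List.finRange n).map (Fin.castAdd m) ∧
        (List.ofFn ⇑ρ⁻¹).filter (fun x => !decide (x.val < n)) =
          (List.finRange m).map (Fin.natAdd n) := by
  rw [← filter_finRange_add_left, ← filter_finRange_add_right, filter_ofFn_perm_eq_iff,
    filter_ofFn_perm_eq_iff, mem_shuffles]
  refine and_congr ⟨fun h a b ha hb hab => ?_, fun h a b hab => ?_⟩
    ⟨fun h a b ha hb hab => ?_, fun h a b hab => ?_⟩
  · simp only [decide_eq_true_eq] at ha hb
    exact h (show (⟨a, ha⟩ : Fin n) < ⟨b, hb⟩ from hab)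
  · exact h _ _ (by simp) (by simp) hab
  · simp only [Bool.not_eq_true', decide_eq_false_iff_not, not_lt] at ha hb
    have := h (show (⟨a - n, by omega⟩ : Fin m) < ⟨b - n, by omega⟩ by
      simp only [Fin.mk_lt_mk]; omega)
    have e : ∀ x : Fin (n + m), ∀ (hx : n ≤ x.val),
        Fin.natAdd n (⟨x.val - n, by omega⟩ : Fin m) = x := by
      intro x hx; ext; simp; omega
    simpa only [e a ha, e b hb] using this
  · exact h _ _ (by simp) (by simp) (by simpa using hab)

/-- It suffices to shuffle the position words `0 ⋯ n-1` and `n ⋯ n+m-1` and then substitute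
`Fin.append a b`. Positions are distinct, so these shuffles correspond bijectively to the words of
`ρ⁻¹`, even when `a` and `b` repeat letters. -/
theorem sum_shuffles {X N : Type*} [AddCommMonoid N] {n m : ℕ} (a : Fin n → X) (b : Fin m → X)
    (f : List X → N) :
    ∑ ρ ∈ shuffles n m, f (List.ofFn fun i => Fin.append a b (ρ⁻¹ i)) =
      shufSum (List.ofFn a) (List.ofFn b) f := by
  obtain ⟨T, hT, hsum⟩ := exists_finset_shufSum (N := N) (fun x => decide (x.val < n))
    ((List.finRange n).map (Fin.castAdd m)) ((List.finRange m).map (Fin.natAdd n))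
    (by simp) (by simp)
  have ha : List.ofFn a = ((List.finRange n).map (Fin.castAdd m)).map (Fin.append a b) := by
    rw [List.map_map, List.ofFn_eq_map]
    exact List.map_congr_left fun i _ => by simp
  have hb : List.ofFn b = ((List.finRange m).map (Fin.natAdd n)).map (Fin.append a b) := by
    rw [List.map_map, List.ofFn_eq_map]
    exact List.map_congr_left fun i _ => by simp
  rw [ha, hb, shufSum_map, hsum]
  refine Finset.sum_bij (fun ρ _ => List.ofFn ⇑ρ⁻¹) ?_ ?_ ?_ ?_
  · intro ρ hρ
    exact (hT _).2 ((mem_shuffles_iff_filter ρ).1 hρ)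
  · intro ρ _ ρ' _ h
    exact inv_injective (DFunLike.coe_injective (List.ofFn_injective h))
  · intro w hw
    obtain ⟨h1, h2⟩ := (hT w).1 hw
    have hp : w.Perm (List.finRange (n + m)) := by
      refine (List.filter_append_perm (fun x => decide (x.val < n)) w).symm.trans ?_
      rw [h1, h2, ← filter_finRange_add_left, ← filter_finRange_add_right]
      exact List.filter_append_perm _ _
    have hl : w.length = n + m := by simpa using hp.length_eq
    have hinj : Function.Injective fun i : Fin (n + m) => w[i.val]'(by omega) := by
      intro i j hij
      have hnd : w.Nodup := hp.nodup_iff.2 (List.nodup_finRange _)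
      exact Fin.ext ((hnd.getElem_inj_iff).1 hij)
    let τ : Equiv.Perm (Fin (n + m)) :=
      Equiv.ofBijective _ (Finite.injective_iff_bijective.1 hinj)
    have hw' : List.ofFn ⇑τ = w := by
      refine List.ext_getElem (by simp [hl]) fun i h1 h2 => ?_
      simp [τ]
    refine ⟨τ⁻¹, (mem_shuffles_iff_filter _).2 ?_, ?_⟩
    · rw [inv_inv, hw']; exact ⟨h1, h2⟩
    · rw [inv_inv, hw']
  · intro ρ _
    rw [List.map_ofFn]
    rfl

end Shuffles

/-! ### Standardization -/

section Standardization

/-- `σ τ⁻¹` is an order automorphism of a finite chain, hence the identity. -/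
theorem perm_eq_of_lt_iff_lt {n : ℕ} {σ τ : Equiv.Perm (Fin n)}
    (h : ∀ i j, σ i < σ j ↔ τ i < τ j) : σ = τ := by
  have hm : StrictMono ⇑(σ * τ⁻¹) := by
    intro i j hij
    rw [Equiv.Perm.mul_apply, Equiv.Perm.mul_apply, h]
    simpa using hij
  have := Subsingleton.elim (hm.orderIsoOfSurjective _ (σ * τ⁻¹).surjective)
    (OrderIso.refl (Fin n))
  rw [← mul_inv_eq_one]
  ext i
  exact congrArg Fin.val (DFunLike.congr_fun this i)

/-- Stable sorting lists the positions in the lexicographic order of the pairs `(w i, i)`. With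
`perm_eq_of_lt_iff_lt`, this order determines the standardization. -/
theorem standardization_lt_iff {n : ℕ} {α : Type*} [LinearOrder α] (w : Fin n → α)
    (i j : Fin n) :
    standardization w i < standardization w j ↔ w i < w j ∨ w i = w j ∧ i < j := by
  obtain ⟨i, rfl⟩ := (Tuple.sort w).surjective i
  obtain ⟨j, rfl⟩ := (Tuple.sort w).surjective j
  have hs := Tuple.eq_sort_iff'.1 (rfl : Tuple.sort w = Tuple.sort w)
  have : i < j ↔ _ := hs.lt_iff_lt.symm
  simp only [standardization, Equiv.Perm.inv_def, Equiv.symm_apply_apply]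
  rw [this]
  exact Prod.Lex.toLex_lt_toLex

theorem standardization_eq_iff {n : ℕ} {α : Type*} [LinearOrder α] {w : Fin n → α}
    {σ : Equiv.Perm (Fin n)} :
    standardization w = σ ↔ ∀ i j, (w i < w j ∨ w i = w j ∧ i < j) ↔ σ i < σ j := by
  constructor
  · rintro rfl i j
    exact (standardization_lt_iff w i j).symm
  · intro h
    exact perm_eq_of_lt_iff_lt fun i j => (standardization_lt_iff w i j).trans (h i j)

/-- Injectivity excludes ties, which are broken by position and so would not follow `ρ`. -/
theorem standardization_comp_perm {n : ℕ} {α : Type*} [LinearOrder α] {w : Fin n → α}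
    (hw : Function.Injective w) (ρ : Equiv.Perm (Fin n)) :
    standardization (fun i => w (ρ i)) = standardization w * ρ := by
  rw [standardization_eq_iff]
  intro i j
  rw [Equiv.Perm.mul_apply, Equiv.Perm.mul_apply, standardization_lt_iff]
  simp only [hw.eq_iff]
  constructor
  · rintro (h | ⟨h, h'⟩)
    · exact Or.inl h
    · exact absurd (ρ.injective h) h'.ne
  · rintro (h | ⟨h, h'⟩)
    · exact Or.inl h
    · exact absurd h h'.ne

/-- Standardization only depends on the relative order of the letters. -/
theorem standardization_restrict {n k : ℕ} {α : Type*} [LinearOrder α] (w : Fin n → α)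
    (e : Fin k → Fin n) (he : StrictMono e) :
    standardization (fun i => standardization w (e i)) = standardization fun i => w (e i) := by
  rw [standardization_eq_iff]
  intro i j
  rw [standardization_lt_iff, standardization_lt_iff, he.lt_iff_lt,
    (standardization w).injective.eq_iff, he.injective.eq_iff]
  refine or_iff_left_of_imp ?_
  rintro ⟨rfl, h⟩
  exact absurd h (lt_irrefl _)

theorem standardization_perm_add {n : ℕ} (σ : Equiv.Perm (Fin n)) (c : ℕ) :
    standardization (fun i => (σ i : ℕ) + c) = σ := by
  rw [standardization_eq_iff]
  intro i j
  rw [add_lt_add_iff_right, Nat.add_right_cancel_iff, ← Fin.ext_iff, σ.injective.eq_iff]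
  refine or_iff_left_of_imp ?_
  rintro ⟨rfl, h⟩
  exact absurd h (lt_irrefl _)

theorem crossPerm_castAdd {n m : ℕ} (σ : Equiv.Perm (Fin n)) (τ : Equiv.Perm (Fin m))
    (i : Fin n) : crossPerm σ τ (Fin.castAdd m i) = Fin.castAdd m (σ i) := by
  simp [crossPerm]

theorem crossPerm_natAdd {n m : ℕ} (σ : Equiv.Perm (Fin n)) (τ : Equiv.Perm (Fin m))
    (j : Fin m) : crossPerm σ τ (Fin.natAdd n j) = Fin.natAdd n (τ j) := by
  simp [crossPerm]

theorem crossPerm_inv {n m : ℕ} (σ : Equiv.Perm (Fin n)) (τ : Equiv.Perm (Fin m)) :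
    (crossPerm σ τ)⁻¹ = crossPerm σ⁻¹ τ⁻¹ := by
  rw [inv_eq_iff_mul_eq_one]
  ext i
  refine Fin.addCases (fun i => ?_) (fun i => ?_) i
  · simp [crossPerm_castAdd]
  · simp [crossPerm_natAdd]

theorem standardization_append {n m : ℕ} {α : Type*} [LinearOrder α] (k : Fin n → α)
    (k' : Fin m → α) (h : ∀ i j, k i < k' j) :
    standardization (Fin.append k k') = crossPerm (standardization k) (standardization k') := by
  rw [standardization_eq_iff]
  intro i j
  refine Fin.addCases (fun i => ?_) (fun i => ?_) i <;>
    refine Fin.addCases (fun j => ?_) (fun j => ?_) j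
  · simp only [Fin.append_left, crossPerm_castAdd, (Fin.strictMono_castAdd m).lt_iff_lt,
      standardization_lt_iff]
  · simp [crossPerm_castAdd, crossPerm_natAdd, h i j, Fin.lt_def]
    omega
  · have h1 := h j i
    simp [crossPerm_castAdd, crossPerm_natAdd, h1.not_gt, h1.ne', Fin.lt_def]
    omega
  · simp only [Fin.append_right, crossPerm_natAdd, Fin.natAdd_lt_natAdd_iff,
      standardization_lt_iff]

end Standardization

/-! ### Bilinear maps on shuffle and deconcatenation sums -/

section Bilinear

variable {K X M₁ M₂ M₃ : Type*} [CommRing K] [AddCommMonoid M₁] [AddCommMonoid M₂]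
  [AddCommMonoid M₃] [Module K M₁] [Module K M₂] [Module K M₃] (B : M₁ →ₗ[K] M₂ →ₗ[K] M₃)

theorem map₂_shufSum (u v u' v' : List X) (f : List X → M₁) (g : List X → M₂) :
    B (shufSum u v f) (shufSum u' v' g) =
      shufSum u v fun x => shufSum u' v' fun y => B (f x) (g y) := by
  refine (map_shufSum (B.flip (shufSum u' v' g)) u v f).trans ?_
  exact shufSum_congr fun x _ => map_shufSum (B (f x)) u' v' g

theorem map₂_deconSum (u v : List X) (f : List X → List X → M₁) (g : List X → List X → M₂) :
    B (deconSum u f) (deconSum v g) =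
      deconSum u fun u₁ u₂ => deconSum v fun v₁ v₂ => B (f u₁ u₂) (g v₁ v₂) := by
  refine (map_deconSum (B.flip (deconSum v g)) u f).trans ?_
  exact deconSum_congr fun x y _ => map_deconSum (B (f x y)) v g

end Bilinear

/-! ### Bounds and distinctness for the letters of biletter words -/

section Words

variable {V : Type*}

theorem exists_forall_lt (u : List (V × ℕ)) : ∃ c, ∀ x ∈ u, x.2 < c := by
  induction u with
  | nil => exact ⟨0, by simp⟩
  | cons x u ih =>
    obtain ⟨c, hc⟩ := ih
    refine ⟨max c (x.2 + 1), ?_⟩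
    simp only [List.mem_cons, forall_eq_or_imp, lt_max_iff]
    exact ⟨Or.inr (Nat.lt_succ_self _), fun y hy => Or.inl (hc y hy)⟩

theorem nodup_of_perm_append {u v w : List (V × ℕ)} (hu : (u.map Prod.snd).Nodup)
    (hv : (v.map Prod.snd).Nodup) (huv : ∀ x ∈ u, ∀ y ∈ v, x.2 < y.2) (h : w.Perm (u ++ v)) :
    (w.map Prod.snd).Nodup := by
  rw [(h.map _).nodup_iff, List.map_append, List.nodup_append]
  refine ⟨hu, hv, ?_⟩
  simp only [List.mem_map]
  rintro _ ⟨x, hx, rfl⟩ _ ⟨y, hy, rfl⟩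
  exact (huv x hx y hy).ne

end Words

section Module

variable (K : Type*) [CommRing K] {V : Type*} [AddCommGroup V] [Module K V]

/-! ### Pure elements -/

@[simp] theorem liftComp_sharp {n : ℕ} {M : Type*} [AddCommMonoid M] [Module K M]
    (f : Equiv.Perm (Fin n) → (⨂[K]^n V) →ₗ[K] M) (σ : Equiv.Perm (Fin n)) (t : ⨂[K]^n V) :
    liftComp K f (sharp K σ t) = f σ t := by
  simp [liftComp, sharp, MonoidAlgebra.coeffLinearEquiv]

theorem permTensor_tprod {n : ℕ} (π : Equiv.Perm (Fin n)) (a : Fin n → V) :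
    permTensor K π (PiTensorProduct.tprod K a) =
      PiTensorProduct.tprod K fun i => a (π⁻¹ i) :=
  PiTensorProduct.reindex_tprod _ _

theorem mulEquiv_tprod {n m : ℕ} (a : Fin n → V) (b : Fin m → V) :
    TensorPower.mulEquiv (PiTensorProduct.tprod K a ⊗ₜ[K] PiTensorProduct.tprod K b) =
      PiTensorProduct.tprod K (Fin.append a b) :=
  TensorPower.tprod_mul_tprod K a b

theorem concat_tprod {n m : ℕ} (a : Fin n → V) (b : Fin m → V) :
    concat K n m (PiTensorProduct.tprod K a) (PiTensorProduct.tprod K b) =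
      PiTensorProduct.tprod K (Fin.append a b) :=
  mulEquiv_tprod K a b

theorem split_tprod {n p q : ℕ} (h : p + q = n) (a : Fin n → V) :
    split K h (PiTensorProduct.tprod K a) =
      PiTensorProduct.tprod K (fun i => a (Fin.cast h (Fin.castAdd q i))) ⊗ₜ[K]
        PiTensorProduct.tprod K (fun j => a (Fin.cast h (Fin.natAdd p j))) := by
  subst h
  simp only [split, LinearMap.comp_apply, LinearEquiv.coe_coe]
  rw [LinearEquiv.symm_apply_eq, mulEquiv_tprod, TensorPower.cast_tprod]
  congr 1
  exact Fin.append_castAdd_natAdd.symm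

/-- The element `(a₁ ⊗ ⋯ ⊗ aₙ) # σ` of `F(V)`. -/
def pureElem {n : ℕ} (σ : Equiv.Perm (Fin n)) (a : Fin n → V) : FQ K V :=
  DirectSum.lof K ℕ (Comp K V) n (sharp K σ (PiTensorProduct.tprod K a))

variable {K} in
theorem comp_hom_ext {n : ℕ} {N : Type*} [AddCommMonoid N] [Module K N]
    {f g : Comp K V n →ₗ[K] N} (h : ∀ σ t, f (sharp K σ t) = g (sharp K σ t)) : f = g := by
  refine TensorProduct.ext' fun t x => ?_
  induction x using MonoidAlgebra.induction_linear with
  | zero => simp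
  | add x y hx hy => rw [TensorProduct.tmul_add, map_add, map_add, hx, hy]
  | single σ c =>
    have : MonoidAlgebra.single σ c = c • MonoidAlgebra.single σ (1 : K) := by simp
    rw [this, TensorProduct.tmul_smul, map_smul, map_smul]
    exact congrArg _ (h σ t)

variable {K} in
theorem hom_ext_sharp {N : Type*} [AddCommMonoid N] [Module K N] {f g : FQ K V →ₗ[K] N}
    (h : ∀ (n : ℕ) (σ : Equiv.Perm (Fin n)) (t : ⨂[K]^n V),
      f (DirectSum.lof K ℕ (Comp K V) n (sharp K σ t)) =
        g (DirectSum.lof K ℕ (Comp K V) n (sharp K σ t))) : f = g := by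
  refine DirectSum.linearMap_ext K fun n => comp_hom_ext fun σ t => ?_
  exact h n σ t

variable {K} in
theorem hom_ext_pure {N : Type*} [AddCommMonoid N] [Module K N] {f g : FQ K V →ₗ[K] N}
    (h : ∀ (n : ℕ) (σ : Equiv.Perm (Fin n)) (a : Fin n → V),
      f (pureElem K σ a) = g (pureElem K σ a)) : f = g := by
  refine hom_ext_sharp fun n σ t => ?_
  refine LinearMap.congr_fun (f := f ∘ₗ DirectSum.lof K ℕ (Comp K V) n ∘ₗ sharp K σ)
    (g := g ∘ₗ DirectSum.lof K ℕ (Comp K V) n ∘ₗ sharp K σ) ?_ t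
  exact PiTensorProduct.ext (MultilinearMap.ext fun a => h n σ a)

theorem extMul_lof {n m : ℕ} (x : Comp K V n) (y : Comp K V m) :
    extMul K (DirectSum.lof K ℕ (Comp K V) n x) (DirectSum.lof K ℕ (Comp K V) m y) =
      DirectSum.lof K ℕ (Comp K V) (n + m) (extMulComp K n m x y) := by
  simp [extMul]

theorem extMulComp_sharp {n m : ℕ} (σ : Equiv.Perm (Fin n)) (τ : Equiv.Perm (Fin m))
    (s : ⨂[K]^n V) (t : ⨂[K]^m V) :
    extMulComp K n m (sharp K σ s) (sharp K τ t) =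
      ∑ ρ ∈ shuffles n m, sharp K (ρ * crossPerm σ τ) (permTensor K ρ (concat K n m s t)) := by
  simp [extMulComp, permAct]

theorem extMul_pure {n m : ℕ} (σ : Equiv.Perm (Fin n)) (τ : Equiv.Perm (Fin m))
    (a : Fin n → V) (b : Fin m → V) :
    extMul K (pureElem K σ a) (pureElem K τ b) =
      ∑ ρ ∈ shuffles n m, pureElem K (ρ * crossPerm σ τ) fun i => Fin.append a b (ρ⁻¹ i) := by
  simp only [pureElem, extMul_lof, extMulComp_sharp, concat_tprod, permTensor_tprod, map_sum]

theorem coprod_lof {n : ℕ} (x : Comp K V n) :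
    coprod K V (DirectSum.lof K ℕ (Comp K V) n x) =
      ∑ pq : {pq : ℕ × ℕ // pq ∈ Finset.HasAntidiagonal.antidiagonal n},
        TensorProduct.map (DirectSum.lof K ℕ (Comp K V) pq.1.1)
          (DirectSum.lof K ℕ (Comp K V) pq.1.2)
          (coprodComp K (Finset.HasAntidiagonal.mem_antidiagonal.1 pq.2) x) := by
  simp [coprod]

theorem coprod_pure {n : ℕ} (σ : Equiv.Perm (Fin n)) (a : Fin n → V) :
    coprod K V (pureElem K σ a) =
      ∑ pq : {pq : ℕ × ℕ // pq ∈ Finset.HasAntidiagonal.antidiagonal n},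
        pureElem K (leftPart (Finset.HasAntidiagonal.mem_antidiagonal.1 pq.2) σ)
            (fun i => a (Fin.cast (Finset.HasAntidiagonal.mem_antidiagonal.1 pq.2)
              (Fin.castAdd pq.1.2 i))) ⊗ₜ[K]
          pureElem K (rightPart (Finset.HasAntidiagonal.mem_antidiagonal.1 pq.2) σ)
            (fun j => a (Fin.cast (Finset.HasAntidiagonal.mem_antidiagonal.1 pq.2)
              (Fin.natAdd pq.1.1 j))) := by
  simp only [pureElem, coprod_lof, coprodComp, liftComp_sharp, LinearMap.comp_apply, split_tprod,
    TensorProduct.map_tmul]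

/-! ### Words of biletters -/

/-- The element of `F(V)` of a word of biletters `(a, k)`: the tensor of the `a`'s together with
the inverse of the standardization of the word of the `k`'s. -/
def wordElem (u : List (V × ℕ)) : FQ K V :=
  pureElem K (standardization fun i : Fin u.length => (u.get i).2)⁻¹ fun i => (u.get i).1

/-- Keeping the length as a variable lets `subst` remove the transport between degrees. -/
theorem wordElem_eq_of_length {n : ℕ} (u : List (V × ℕ)) (h : u.length = n) (f : Fin n → V × ℕ)
    (hf : ∀ i, f i = u.get (Fin.cast h.symm i)) :
    wordElem K u = pureElem K (standardization fun i => (f i).2)⁻¹ fun i => (f i).1 := by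
  subst h
  obtain rfl : f = u.get := funext hf
  rfl

theorem wordElem_ofFn {n : ℕ} (f : Fin n → V × ℕ) :
    wordElem K (List.ofFn f) =
      pureElem K (standardization fun i => (f i).2)⁻¹ fun i => (f i).1 :=
  wordElem_eq_of_length K _ (by simp) f fun i => by simp

theorem pureElem_eq_wordElem {n : ℕ} (σ : Equiv.Perm (Fin n)) (a : Fin n → V) (c : ℕ) :
    pureElem K σ a = wordElem K (List.ofFn fun i => (a i, (σ⁻¹ i : ℕ) + c)) := by
  rw [wordElem_ofFn, standardization_perm_add, inv_inv]

variable {K} in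
-- Shifting all letters does not change the standardization. The freedom in `c` puts the letters of
-- a later factor above those of the earlier ones, as `extMul_wordElem` requires.
theorem hom_ext_word (c : ℕ) {N : Type*} [AddCommMonoid N] [Module K N] {f g : FQ K V →ₗ[K] N}
    (h : ∀ u : List (V × ℕ), (u.map Prod.snd).Nodup → (∀ x ∈ u, c ≤ x.2) →
      f (wordElem K u) = g (wordElem K u)) : f = g := by
  refine hom_ext_pure fun n σ a => ?_
  rw [pureElem_eq_wordElem K σ a c]
  refine h _ ?_ ?_
  · rw [List.map_ofFn, List.nodup_ofFn]
    intro i j hij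
    simpa [Fin.val_inj] using hij
  · simp [List.mem_ofFn]

/-- The external product of two words, all letters of the first being smaller than those of the
second, is the sum of their shuffles. -/
theorem extMul_wordElem {u v : List (V × ℕ)} (hu : (u.map Prod.snd).Nodup)
    (hv : (v.map Prod.snd).Nodup) (huv : ∀ x ∈ u, ∀ y ∈ v, x.2 < y.2) :
    extMul K (wordElem K u) (wordElem K v) = shufSum u v (wordElem K) := by
  obtain ⟨n, a, rfl⟩ : ∃ n, ∃ a : Fin n → V × ℕ, u = List.ofFn a :=
    ⟨_, u.get, (List.ofFn_get u).symm⟩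
  obtain ⟨m, b, rfl⟩ : ∃ n, ∃ a : Fin n → V × ℕ, v = List.ofFn a :=
    ⟨_, v.get, (List.ofFn_get v).symm⟩
  rw [List.map_ofFn, List.nodup_ofFn] at hu hv
  simp only [List.mem_ofFn, forall_exists_index, forall_apply_eq_imp_iff] at huv
  have e1 : (fun i => (Fin.append a b i).1) =
      Fin.append (fun i => (a i).1) (fun i => (b i).1) := by
    ext i; refine Fin.addCases (fun i => ?_) (fun i => ?_) i <;> simp
  have e2 : (fun i => (Fin.append a b i).2) =
      Fin.append (fun i => (a i).2) (fun i => (b i).2) := by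
    ext i; refine Fin.addCases (fun i => ?_) (fun i => ?_) i <;> simp
  have hinj : Function.Injective fun i => (Fin.append a b i).2 := by
    rw [e2, Fin.append_injective_iff]
    exact ⟨hu, hv, fun i j => (huv i j).ne⟩
  rw [← sum_shuffles, wordElem_ofFn, wordElem_ofFn, extMul_pure]
  refine Finset.sum_congr rfl fun ρ _ => ?_
  -- The shuffled word standardizes to `(σ⁻¹ × τ⁻¹) ρ⁻¹`, the inverse of `ρ (σ × τ)`.
  rw [wordElem_ofFn, standardization_comp_perm hinj, e2, standardization_append _ _ huv,
    ← crossPerm_inv, mul_inv_rev, inv_inv]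
  congr 1
  ext i
  exact (congrFun e1 (ρ⁻¹ i)).symm

/-- Repeated letters are harmless here: a factor keeps the relative order of its positions, hence
also the breaking of ties. -/
theorem coprod_wordElem (u : List (V × ℕ)) :
    coprod K V (wordElem K u) = deconSum u fun x y => wordElem K x ⊗ₜ[K] wordElem K y := by
  obtain ⟨n, a, rfl⟩ : ∃ n, ∃ a : Fin n → V × ℕ, u = List.ofFn a :=
    ⟨_, u.get, (List.ofFn_get u).symm⟩
  rw [deconSum_ofFn, wordElem_ofFn, coprod_pure]
  refine Finset.sum_congr rfl fun pq _ => ?_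
  rw [wordElem_ofFn, wordElem_ofFn, leftPart, rightPart, inv_inv]
  have h := Finset.HasAntidiagonal.mem_antidiagonal.1 pq.2
  rw [standardization_restrict (fun i => (a i).2) (fun i => Fin.cast h (Fin.castAdd pq.1.2 i))
      (fun i j hij => hij),
    standardization_restrict (fun i => (a i).2) (fun i => Fin.cast h (Fin.natAdd pq.1.1 i))
      (fun i j hij => Nat.add_lt_add_left hij pq.1.1)]

theorem unit_eq_wordElem : unit K V = wordElem K ([] : List (V × ℕ)) := by
  have h := wordElem_ofFn K fun i : Fin 0 => (i.elim0 : V × ℕ)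
  rw [List.ofFn_zero] at h
  rw [h, unit]
  exact congrArg₂ (pureElem K) (Subsingleton.elim _ _) (funext fun i => i.elim0)

theorem unit_extMul (x : FQ K V) : extMul K (unit K V) x = x := by
  refine LinearMap.congr_fun (f := extMul K (unit K V)) (g := LinearMap.id) ?_ x
  refine hom_ext_word 0 fun u hu _ => ?_
  rw [unit_eq_wordElem, extMul_wordElem K (by simp) hu (by simp), shufSum_nil_left,
    LinearMap.id_apply]

theorem extMul_unit (x : FQ K V) : extMul K x (unit K V) = x := by
  refine LinearMap.congr_fun (f := (extMul K).flip (unit K V)) (g := LinearMap.id) ?_ x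
  refine hom_ext_word 0 fun u hu _ => ?_
  rw [unit_eq_wordElem, LinearMap.flip_apply, extMul_wordElem K hu (by simp) (by simp),
    shufSum_nil_right, LinearMap.id_apply]

/-- Test on three words with successively larger alphabets; every product is then a shuffle, and
`shufSum_assoc` applies. -/
theorem extMul_assoc (x y z : FQ K V) :
    extMul K (extMul K x y) z = extMul K x (extMul K y z) := by
  refine LinearMap.congr_fun (f := (extMul K).flip z ∘ₗ (extMul K).flip y)
    (g := (extMul K).flip (extMul K y z)) ?_ x
  refine hom_ext_word 0 fun u hu _ => ?_
  obtain ⟨c, hc⟩ := exists_forall_lt u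
  refine LinearMap.congr_fun (f := (extMul K).flip z ∘ₗ (extMul K (wordElem K u)))
    (g := extMul K (wordElem K u) ∘ₗ (extMul K).flip z) ?_ y
  refine hom_ext_word c fun v hv hcv => ?_
  obtain ⟨d, hd⟩ := exists_forall_lt (u ++ v)
  refine LinearMap.congr_fun (f := extMul K (extMul K (wordElem K u) (wordElem K v)))
    (g := extMul K (wordElem K u) ∘ₗ extMul K (wordElem K v)) ?_ z
  refine hom_ext_word d fun w hw hdw => ?_
  have huv : ∀ x ∈ u, ∀ y ∈ v, x.2 < y.2 := fun x hx y hy => (hc x hx).trans_le (hcv y hy)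
  have huw : ∀ x ∈ u, ∀ y ∈ w, x.2 < y.2 := fun x hx y hy =>
    (hd x (by simp [hx])).trans_le (hdw y hy)
  have hvw : ∀ x ∈ v, ∀ y ∈ w, x.2 < y.2 := fun x hx y hy =>
    (hd x (by simp [hx])).trans_le (hdw y hy)
  rw [LinearMap.comp_apply, extMul_wordElem K hu hv huv, extMul_wordElem K hv hw hvw,
    ← LinearMap.flip_apply (extMul K), map_shufSum, map_shufSum]
  simp only [LinearMap.flip_apply]
  rw [shufSum_congr (u := u) (v := v) (g := fun x => shufSum x w (wordElem K)),
    shufSum_congr (u := v) (v := w) (g := fun x => shufSum u x (wordElem K)), shufSum_assoc]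
  · intro y hy
    refine extMul_wordElem K hu (nodup_of_perm_append hv hw hvw hy) fun s hs t ht => ?_
    rcases List.mem_append.1 (hy.mem_iff.1 ht) with ht | ht
    exacts [huv s hs t ht, huw s hs t ht]
  · intro y hy
    refine extMul_wordElem K (nodup_of_perm_append hu hv huv hy) hw fun s hs t ht => ?_
    rcases List.mem_append.1 (hy.mem_iff.1 hs) with hs | hs
    exacts [huw s hs t ht, hvw s hs t ht]

variable (V) in
/-- The external product of `F(V) ⊗ F(V)`. -/
def extMulTensor : FQ K V ⊗[K] FQ K V →ₗ[K] FQ K V ⊗[K] FQ K V →ₗ[K] FQ K V ⊗[K] FQ K V :=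
  TensorProduct.map₂ (extMul K) (extMul K)

theorem extMulTensor_tmul (x x' y y' : FQ K V) :
    extMulTensor K V (x ⊗ₜ x') (y ⊗ₜ y') = extMul K x y ⊗ₜ extMul K x' y' := by
  simp [extMulTensor]

/-- The coproduct is multiplicative for the external product. -/
theorem coprod_extMul (x y : FQ K V) :
    coprod K V (extMul K x y) = extMulTensor K V (coprod K V x) (coprod K V y) := by
  refine LinearMap.congr_fun (f := coprod K V ∘ₗ (extMul K).flip y)
    (g := (extMulTensor K V).flip (coprod K V y) ∘ₗ coprod K V) ?_ x
  refine hom_ext_word 0 fun u hu _ => ?_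
  obtain ⟨c, hc⟩ := exists_forall_lt u
  refine LinearMap.congr_fun (f := coprod K V ∘ₗ extMul K (wordElem K u))
    (g := extMulTensor K V (coprod K V (wordElem K u)) ∘ₗ coprod K V) ?_ y
  refine hom_ext_word c fun v hv hcv => ?_
  have huv : ∀ x ∈ u, ∀ y ∈ v, x.2 < y.2 := fun x hx y hy => (hc x hx).trans_le (hcv y hy)
  rw [LinearMap.comp_apply, LinearMap.comp_apply, extMul_wordElem K hu hv huv, map_shufSum]
  simp only [coprod_wordElem]
  rw [shufSum_deconSum, ← LinearMap.flip_apply (extMulTensor K V), map_deconSum]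
  refine deconSum_congr fun u₁ u₂ hu' => ?_
  rw [LinearMap.flip_apply, map_deconSum]
  refine deconSum_congr fun v₁ v₂ hv' => ?_
  subst hu' hv'
  rw [List.map_append] at hu hv
  have hu := List.nodup_append.1 hu
  have hv := List.nodup_append.1 hv
  rw [extMulTensor_tmul, extMul_wordElem K hu.1 hv.1 fun x hx y hy => huv x (by simp [hx]) y
    (by simp [hy]), extMul_wordElem K hu.2.1 hv.2.1 fun x hx y hy => huv x (by simp [hx]) y
    (by simp [hy])]
  exact (map₂_shufSum (TensorProduct.mk K (FQ K V) (FQ K V)) _ _ _ _ _ _).symm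

end Module

/-! ### The shuffle algebra of a module -/

section Shuffle

variable (K : Type*) [CommRing K] (M : Type*) [AddCommGroup M] [Module K M]

/-- The tensor module `⨁ n, M^{⊗ n}`, on which the shuffle product is defined. -/
abbrev TensorSum : Type _ := ⨁ n : ℕ, ⨂[K]^n M

variable {M}

/-- The tensor `m₁ ⊗ ⋯ ⊗ mₙ` of a list. -/
def listTensor (u : List M) : TensorSum K M :=
  DirectSum.lof K ℕ (fun n => ⨂[K]^n M) u.length (PiTensorProduct.tprod K u.get)

theorem listTensor_eq_of_length {n : ℕ} (u : List M) (h : u.length = n) (f : Fin n → M)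
    (hf : ∀ i, f i = u.get (Fin.cast h.symm i)) :
    listTensor K u = DirectSum.lof K ℕ (fun n => ⨂[K]^n M) n (PiTensorProduct.tprod K f) := by
  subst h
  obtain rfl : f = u.get := funext hf
  rfl

theorem listTensor_ofFn {n : ℕ} (f : Fin n → M) :
    listTensor K (List.ofFn f) =
      DirectSum.lof K ℕ (fun n => ⨂[K]^n M) n (PiTensorProduct.tprod K f) :=
  listTensor_eq_of_length K _ (by simp) f fun i => by simp

variable {K} in
theorem hom_ext_list {N : Type*} [AddCommMonoid N] [Module K N] {f g : TensorSum K M →ₗ[K] N}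
    (h : ∀ u : List M, f (listTensor K u) = g (listTensor K u)) : f = g := by
  refine DirectSum.linearMap_ext K fun n => PiTensorProduct.ext (MultilinearMap.ext fun a => ?_)
  have := h (List.ofFn a)
  rwa [listTensor_ofFn] at this

variable (M) in
/-- The shuffle product of `⨁ n, M^{⊗ n}`. -/
def shufMul : TensorSum K M →ₗ[K] TensorSum K M →ₗ[K] TensorSum K M :=
  DirectSum.toModule K ℕ _ fun n => LinearMap.flip <|
    DirectSum.toModule K ℕ _ fun m => LinearMap.flip <|
      (concat K n m).compr₂
        (DirectSum.lof K ℕ (fun n => ⨂[K]^n M) (n + m) ∘ₗ ∑ ρ ∈ shuffles n m, permTensor K ρ)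

theorem shufMul_lof {n m : ℕ} (s : ⨂[K]^n M) (t : ⨂[K]^m M) :
    shufMul K M (DirectSum.lof K ℕ (fun n => ⨂[K]^n M) n s)
        (DirectSum.lof K ℕ (fun n => ⨂[K]^n M) m t) =
      ∑ ρ ∈ shuffles n m,
        DirectSum.lof K ℕ (fun n => ⨂[K]^n M) (n + m) (permTensor K ρ (concat K n m s t)) := by
  simp [shufMul]

theorem shufMul_listTensor (u v : List M) :
    shufMul K M (listTensor K u) (listTensor K v) = shufSum u v (listTensor K) := by
  obtain ⟨n, a, rfl⟩ : ∃ n, ∃ a : Fin n → M, u = List.ofFn a :=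
    ⟨_, u.get, (List.ofFn_get u).symm⟩
  obtain ⟨m, b, rfl⟩ : ∃ n, ∃ a : Fin n → M, v = List.ofFn a :=
    ⟨_, v.get, (List.ofFn_get v).symm⟩
  simp only [← sum_shuffles, listTensor_ofFn, shufMul_lof, concat_tprod, permTensor_tprod]

theorem shufMul_comm (x y : TensorSum K M) : shufMul K M x y = shufMul K M y x := by
  suffices shufMul K M = (shufMul K M).flip from
    LinearMap.congr_fun (LinearMap.congr_fun this x) y
  refine hom_ext_list fun u => hom_ext_list fun v => ?_
  rw [LinearMap.flip_apply, shufMul_listTensor, shufMul_listTensor, shufSum_comm]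

theorem shufMul_assoc (x y z : TensorSum K M) :
    shufMul K M (shufMul K M x y) z = shufMul K M x (shufMul K M y z) := by
  refine LinearMap.congr_fun (f := (shufMul K M).flip z ∘ₗ (shufMul K M).flip y)
    (g := (shufMul K M).flip (shufMul K M y z)) (hom_ext_list fun u => ?_) x
  refine LinearMap.congr_fun (f := (shufMul K M).flip z ∘ₗ shufMul K M (listTensor K u))
    (g := shufMul K M (listTensor K u) ∘ₗ (shufMul K M).flip z) (hom_ext_list fun v => ?_) y
  refine LinearMap.congr_fun (f := shufMul K M (shufMul K M (listTensor K u) (listTensor K v)))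
    (g := shufMul K M (listTensor K u) ∘ₗ shufMul K M (listTensor K v))
    (hom_ext_list fun w => ?_) z
  rw [LinearMap.comp_apply, shufMul_listTensor, shufMul_listTensor,
    map_shufSum (shufMul K M (listTensor K u))]
  refine (map_shufSum ((shufMul K M).flip (listTensor K w)) u v _).trans ?_
  simp only [LinearMap.flip_apply, shufMul_listTensor]
  exact shufSum_assoc u v w _

theorem shufMul_mul_mul_comm (a b c d : TensorSum K M) :
    shufMul K M (shufMul K M a b) (shufMul K M c d) =
      shufMul K M (shufMul K M a c) (shufMul K M b d) := by
  rw [shufMul_assoc, shufMul_assoc, ← shufMul_assoc K b c d, shufMul_comm K b c,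
    shufMul_assoc K c b d]

end Shuffle

/-! ### The action of `F(A)` on the tensors of an `A`-module -/

section

variable (K : Type*) [CommRing K]

theorem tensor_hom_ext₂ {V W N : Type*} [AddCommGroup V] [Module K V] [AddCommGroup W] [Module K W]
     [AddCommMonoid N] [Module K N] {n m : ℕ}
    {f g : (⨂[K]^n V) →ₗ[K] (⨂[K]^m W) →ₗ[K] N}
    (h : ∀ a b, f (PiTensorProduct.tprod K a) (PiTensorProduct.tprod K b) =
      g (PiTensorProduct.tprod K a) (PiTensorProduct.tprod K b)) : f = g :=
  PiTensorProduct.ext <| MultilinearMap.ext fun a =>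
    PiTensorProduct.ext <| MultilinearMap.ext fun b => h a b

end

section Action

variable (K : Type*) [CommRing K] (A : Type*) [Ring A] [Algebra K A]
  (M : Type*) [AddCommGroup M] [Module K M] [Module A M] [IsScalarTower K A M]

variable {A} in
/-- The action of the algebra `A^{⊗ n}` on `M^{⊗ n}`. -/
def tensorAct (n : ℕ) : (⨂[K]^n A) →ₗ[K] (⨂[K]^n M) →ₗ[K] (⨂[K]^n M) :=
  PiTensorProduct.map₂ fun _ => (Algebra.lsmul K K M : A →ₐ[K] Module.End K M).toLinearMap

variable {A} in
/-- The action of the twisted group ring `F_n(A)` on `M^{⊗ n}`. -/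
def actComp (n : ℕ) : Comp K A n →ₗ[K] (⨂[K]^n M) →ₗ[K] (⨂[K]^n M) :=
  liftComp K fun σ => (tensorAct K M n).compl₂ (permTensor K σ)

/-- The action of `F(A)` on `⨁ n, M^{⊗ n}`, elements of different degrees having product zero. -/
def act : FQ K A →ₗ[K] TensorSum K M →ₗ[K] TensorSum K M :=
  DirectSum.toModule K ℕ _ fun n =>
    ((actComp K M n).compr₂ (DirectSum.lof K ℕ (fun n => ⨂[K]^n M) n)).compl₂
      (DirectSum.component K ℕ (fun n => ⨂[K]^n M) n)

variable {A M}

theorem tensorAct_tprod {n : ℕ} (a : Fin n → A) (f : Fin n → M) :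
    tensorAct K M n (PiTensorProduct.tprod K a) (PiTensorProduct.tprod K f) =
      PiTensorProduct.tprod K fun i => a i • f i :=
  PiTensorProduct.map₂_tprod_tprod _ _ _

theorem tensorAct_permTensor {n : ℕ} (π : Equiv.Perm (Fin n)) (t : ⨂[K]^n A) (w : ⨂[K]^n M) :
    tensorAct K M n (permTensor K π t) (permTensor K π w) =
      permTensor K π (tensorAct K M n t w) := by
  refine LinearMap.congr_fun₂
    (f := (tensorAct K M n).compl₁₂ (permTensor K π) (permTensor K π))
    (g := (tensorAct K M n).compr₂ (permTensor K π)) (tensor_hom_ext₂ K fun a f => ?_) t w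
  simp [permTensor_tprod, tensorAct_tprod]

theorem tensorAct_concat {n m : ℕ} (s : ⨂[K]^n A) (t : ⨂[K]^m A) (x : ⨂[K]^n M)
    (y : ⨂[K]^m M) :
    tensorAct K M (n + m) (concat K n m s t) (concat K n m x y) =
      concat K n m (tensorAct K M n s x) (tensorAct K M m t y) := by
  refine LinearMap.congr_fun₂
    (f := ((tensorAct K M (n + m)).flip.comp ((concat K n m).flip y)).flip.comp
      ((concat K n m).flip t))
    (g := (tensorAct K M n).compr₂ ((concat K n m).flip (tensorAct K M m t y)))
    (tensor_hom_ext₂ K fun a f => ?_) s x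
  refine LinearMap.congr_fun₂
    (f := ((tensorAct K M (n + m)).flip.comp
      (concat K n m (PiTensorProduct.tprod K f))).flip.comp
      (concat K n m (PiTensorProduct.tprod K a)))
    (g := (tensorAct K M m).compr₂ (concat K n m
      (tensorAct K M n (PiTensorProduct.tprod K a) (PiTensorProduct.tprod K f))))
    (tensor_hom_ext₂ K fun b g => ?_) t y
  simp only [LinearMap.comp_apply, LinearMap.flip_apply, LinearMap.compr₂_apply, concat_tprod,
    tensorAct_tprod]
  congr 1
  ext i
  refine Fin.addCases (fun i => ?_) (fun i => ?_) i <;> simp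

theorem act_lof_same {n : ℕ} (x : Comp K A n) (w : ⨂[K]^n M) :
    act K A M (DirectSum.lof K ℕ (Comp K A) n x) (DirectSum.lof K ℕ (fun n => ⨂[K]^n M) n w) =
      DirectSum.lof K ℕ (fun n => ⨂[K]^n M) n (actComp K M n x w) := by
  simp [act, DirectSum.component.lof_self]

theorem act_lof_of_ne {n m : ℕ} (h : n ≠ m) (x : Comp K A n) (w : ⨂[K]^m M) :
    act K A M (DirectSum.lof K ℕ (Comp K A) n x) (DirectSum.lof K ℕ (fun n => ⨂[K]^n M) m w) =
      0 := by
  rw [act, DirectSum.toModule_lof, LinearMap.compl₂_apply, DirectSum.component.of,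
    dif_neg h.symm, map_zero]

theorem act_pure_ofFn {n : ℕ} (σ : Equiv.Perm (Fin n)) (a : Fin n → A) (f : Fin n → M) :
    act K A M (pureElem K σ a) (listTensor K (List.ofFn f)) =
      listTensor K (List.ofFn fun i => a i • f (σ⁻¹ i)) := by
  rw [pureElem, listTensor_ofFn, listTensor_ofFn, act_lof_same, actComp, liftComp_sharp,
    LinearMap.compl₂_apply, permTensor_tprod, tensorAct_tprod]

theorem act_pure_of_length_ne {n : ℕ} (σ : Equiv.Perm (Fin n)) (a : Fin n → A) (u : List M)
    (h : u.length ≠ n) : act K A M (pureElem K σ a) (listTensor K u) = 0 :=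
  act_lof_of_ne K h.symm _ _

/-- The action of an external product on a tensor. -/
theorem act_extMul (x y : FQ K A) (w : List M) :
    act K A M (extMul K x y) (listTensor K w) =
      deconSum w fun w₁ w₂ =>
        shufMul K M (act K A M x (listTensor K w₁)) (act K A M y (listTensor K w₂)) := by
  -- For fixed `w` this is an identity of bilinear maps in `x` and `y`, which can be tested on pure
  -- elements. For these, at most the cut of `w` into lengths `n` and `m` contributes.
  have key : (extMul K).compr₂ ((act K A M).flip (listTensor K w)) =
      deconSum w fun w₁ w₂ => (shufMul K M).compl₁₂ ((act K A M).flip (listTensor K w₁))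
        ((act K A M).flip (listTensor K w₂)) := by
    refine hom_ext_pure fun n σ a => hom_ext_pure fun m τ b => ?_
    rw [← LinearMap.applyₗ_apply_apply (pureElem K σ a) (deconSum w _), map_deconSum,
      ← LinearMap.applyₗ_apply_apply (pureElem K τ b) (deconSum w _), map_deconSum]
    simp only [LinearMap.applyₗ_apply_apply, LinearMap.compr₂_apply, LinearMap.flip_apply,
      LinearMap.compl₁₂_apply]
    obtain ⟨k, f, rfl⟩ : ∃ n, ∃ a : Fin n → M, w = List.ofFn a :=
      ⟨_, w.get, (List.ofFn_get w).symm⟩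
    rw [extMul_pure, map_sum, LinearMap.sum_apply, deconSum_ofFn]
    by_cases hk : k = n + m
    · subst hk
      rw [Finset.sum_eq_single (⟨(n, m), Finset.HasAntidiagonal.mem_antidiagonal.2 rfl⟩ :
        {pq : ℕ × ℕ // pq ∈ Finset.HasAntidiagonal.antidiagonal (n + m)})]
      · rw [act_pure_ofFn, act_pure_ofFn, shufMul_listTensor, ← sum_shuffles]
        refine Finset.sum_congr rfl fun ρ _ => ?_
        rw [act_pure_ofFn]
        congr 2
        ext i
        rw [mul_inv_rev, crossPerm_inv, Equiv.Perm.mul_apply]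
        generalize ρ⁻¹ i = j
        refine Fin.addCases (fun j => ?_) (fun j => ?_) j
        · simp [crossPerm_castAdd]
        · simp [crossPerm_natAdd]
      · rintro ⟨⟨p, q⟩, hpq⟩ _ hne
        have hpq' : p + q = n + m := Finset.HasAntidiagonal.mem_antidiagonal.1 hpq
        rw [act_pure_of_length_ne K σ, map_zero, LinearMap.zero_apply]
        rintro h
        rw [List.length_ofFn] at h
        simp only at h
        exact hne (Subtype.ext (Prod.ext h (by simp only; omega)))
      · simp
    · rw [Finset.sum_eq_zero fun ρ _ => act_pure_of_length_ne K _ _ _ (by simpa using hk),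
        Finset.sum_eq_zero]
      rintro ⟨⟨p, q⟩, hpq⟩ _
      have hpq' : p + q = k := Finset.HasAntidiagonal.mem_antidiagonal.1 hpq
      by_cases hp : p = n
      · rw [act_pure_of_length_ne K τ, map_zero]
        simp only [List.length_ofFn]
        omega
      · rw [act_pure_of_length_ne K σ, map_zero, LinearMap.zero_apply]
        simpa using hp
  have := LinearMap.congr_fun₂ key x y
  rw [← LinearMap.applyₗ_apply_apply x (deconSum w _), map_deconSum,
    ← LinearMap.applyₗ_apply_apply y (deconSum w _), map_deconSum] at this
  exact this

/-- The linear map `x₁ ⊗ x₂ ↦ (x₁ · w₁) ⧢ (x₂ · w₂)`. -/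
def actShuf (w₁ w₂ : TensorSum K M) : FQ K A ⊗[K] FQ K A →ₗ[K] TensorSum K M :=
  TensorProduct.lift ((shufMul K M).compl₁₂ ((act K A M).flip w₁) ((act K A M).flip w₂))

theorem actShuf_tmul (w₁ w₂ : TensorSum K M) (x₁ x₂ : FQ K A) :
    actShuf K w₁ w₂ (x₁ ⊗ₜ x₂) = shufMul K M (act K A M x₁ w₁) (act K A M x₂ w₂) := by
  simp [actShuf]

/-- Convolution in each tensor factor produces four shuffled terms; commutativity of `⧢` exchanges
the middle two. -/
theorem actShuf_extMulTensor (x y : FQ K A ⊗[K] FQ K A) (u v : List M) :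
    actShuf K (listTensor K u) (listTensor K v) (extMulTensor K A x y) =
      deconSum u fun u₁ u₂ => deconSum v fun v₁ v₂ =>
        shufMul K M (actShuf K (listTensor K u₁) (listTensor K v₁) x)
          (actShuf K (listTensor K u₂) (listTensor K v₂) y) := by
  induction x with
  | zero => simp [deconSum_zero]
  | add x x' hx hx' => simp [hx, hx', deconSum_add]
  | tmul x₁ x₂ =>
    induction y with
    | zero => simp [deconSum_zero]
    | add y y' hy hy' => simp [hy, hy', deconSum_add]
    | tmul y₁ y₂ =>
      rw [extMulTensor_tmul, actShuf_tmul, act_extMul, act_extMul, map₂_deconSum]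
      refine deconSum_congr fun u₁ u₂ _ => deconSum_congr fun v₁ v₂ _ => ?_
      rw [actShuf_tmul, actShuf_tmul, shufMul_mul_mul_comm]

variable (M) in
/-- The elements of `F(A)` that satisfy the splitting formula on the shuffle products of two
tensors over `M`. -/
def IsSplitting (x : FQ K A) : Prop :=
  ∀ u v : List M, act K A M x (shufMul K M (listTensor K u) (listTensor K v)) =
    actShuf K (listTensor K u) (listTensor K v) (coprod K A x)

variable {K} in
-- Acting by `x * y` cuts each shuffle of `u` and `v`. By `shufSum_deconSum` this amounts to cutting
-- `u` and `v` first and shuffling the pieces, so that `hx` and `hy` apply to the left and right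
-- pieces.
theorem IsSplitting.mul {x y : FQ K A} (hx : IsSplitting K M x) (hy : IsSplitting K M y) :
    IsSplitting K M (extMul K x y) := by
  intro u v
  rw [coprod_extMul, actShuf_extMulTensor, shufMul_listTensor, map_shufSum]
  simp only [act_extMul]
  rw [shufSum_deconSum]
  refine deconSum_congr fun u₁ u₂ _ => deconSum_congr fun v₁ v₂ _ => ?_
  rw [← hx, ← hy, shufMul_listTensor, shufMul_listTensor, map_shufSum (act K A M x),
    map_shufSum (act K A M y)]
  exact (map₂_shufSum (shufMul K M) _ _ _ _ _ _).symm

end Action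

/-! ### The splitting property of the generators `t # e_n` -/

section Generators

variable (K : Type*) [CommRing K] {V : Type*} [AddCommGroup V] [Module K V]

theorem permTensor_one {n : ℕ} (t : ⨂[K]^n V) : permTensor K 1 t = t := by
  have : (permTensor K 1 : (⨂[K]^n V) →ₗ[K] (⨂[K]^n V)) = LinearMap.id :=
    PiTensorProduct.ext <| MultilinearMap.ext fun a => by simp [permTensor_tprod]
  rw [this, LinearMap.id_apply]

theorem standardization_of_strictMono {n : ℕ} {α : Type*} [LinearOrder α] {w : Fin n → α}
    (hw : StrictMono w) : standardization w = 1 := by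
  rw [standardization_eq_iff]
  intro i j
  rw [hw.lt_iff_lt, hw.injective.eq_iff, Equiv.Perm.one_apply, Equiv.Perm.one_apply]
  refine or_iff_left_of_imp ?_
  rintro ⟨rfl, h⟩
  exact absurd h (lt_irrefl _)

theorem leftPart_one {n p q : ℕ} (h : p + q = n) : leftPart h 1 = 1 := by
  rw [leftPart, standardization_of_strictMono, inv_one]
  exact fun i j hij => hij

theorem rightPart_one {n p q : ℕ} (h : p + q = n) : rightPart h 1 = 1 := by
  rw [rightPart, standardization_of_strictMono, inv_one]
  exact fun i j hij => Nat.add_lt_add_left hij p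

theorem coprod_sharp_one {n : ℕ} (t : ⨂[K]^n V) :
    coprod K V (DirectSum.lof K ℕ (Comp K V) n (sharp K 1 t)) =
      ∑ pq : {pq : ℕ × ℕ // pq ∈ Finset.HasAntidiagonal.antidiagonal n},
        TensorProduct.map (DirectSum.lof K ℕ (Comp K V) pq.1.1 ∘ₗ sharp K 1)
          (DirectSum.lof K ℕ (Comp K V) pq.1.2 ∘ₗ sharp K 1)
          (split K (Finset.HasAntidiagonal.mem_antidiagonal.1 pq.2) t) := by
  simp only [coprod_lof, coprodComp, liftComp_sharp, leftPart_one, rightPart_one,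
    LinearMap.comp_apply, TensorProduct.map_comp]

theorem mulEquiv_split {p q : ℕ} (t : ⨂[K]^(p + q) V) :
    TensorPower.mulEquiv (split K rfl t) = t := by
  simp [split]

variable {A : Type*} [Ring A] [Algebra K A] {M : Type*} [AddCommGroup M] [Module K M]
  [Module A M] [IsScalarTower K A M]

theorem actShuf_lof_of_ne {p q n m : ℕ} (h : (p, q) ≠ (n, m)) (s : (⨂[K]^p A) ⊗[K] (⨂[K]^q A))
    (x : ⨂[K]^n M) (y : ⨂[K]^m M) :
    actShuf K (DirectSum.lof K ℕ (fun n => ⨂[K]^n M) n x)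
      (DirectSum.lof K ℕ (fun n => ⨂[K]^n M) m y)
      (TensorProduct.map (DirectSum.lof K ℕ (Comp K A) p ∘ₗ sharp K 1)
          (DirectSum.lof K ℕ (Comp K A) q ∘ₗ sharp K 1) s) = 0 := by
  induction s with
  | zero => simp
  | add s s' h h' => rw [map_add, map_add, h, h', add_zero]
  | tmul s t =>
    rw [TensorProduct.map_tmul, actShuf_tmul, LinearMap.comp_apply, LinearMap.comp_apply]
    by_cases hp : p = n
    · have hq : q ≠ m := fun hq => h (by rw [hp, hq])
      rw [act_lof_of_ne K hq, map_zero]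
    · rw [act_lof_of_ne K hp, map_zero, LinearMap.zero_apply]

theorem actShuf_lof_same {n m : ℕ} (s : (⨂[K]^n A) ⊗[K] (⨂[K]^m A))
    (x : ⨂[K]^n M) (y : ⨂[K]^m M) :
    actShuf K (DirectSum.lof K ℕ (fun n => ⨂[K]^n M) n x)
      (DirectSum.lof K ℕ (fun n => ⨂[K]^n M) m y)
      (TensorProduct.map (DirectSum.lof K ℕ (Comp K A) n ∘ₗ sharp K 1)
          (DirectSum.lof K ℕ (Comp K A) m ∘ₗ sharp K 1) s) =
      ∑ ρ ∈ shuffles n m, DirectSum.lof K ℕ (fun n => ⨂[K]^n M) (n + m)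
        (permTensor K ρ (tensorAct K M (n + m) (TensorPower.mulEquiv s) (concat K n m x y))) := by
  induction s with
  | zero => simp
  | add s s' h h' =>
    simp only [map_add, LinearMap.add_apply, Finset.sum_add_distrib] at h h' ⊢
    rw [h, h']
  | tmul s t =>
    rw [TensorProduct.map_tmul, actShuf_tmul, LinearMap.comp_apply, LinearMap.comp_apply,
      act_lof_same, act_lof_same, actComp, actComp, liftComp_sharp, liftComp_sharp,
      LinearMap.compl₂_apply, LinearMap.compl₂_apply, permTensor_one, permTensor_one,
      shufMul_lof]
    exact Finset.sum_congr rfl fun ρ _ => congrArg _ <| congrArg _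
      (tensorAct_concat K s t x y).symm

/-- The coproduct only cuts `t`, and only the cut at the lengths of `u` and `v` acts nontrivially.
What remains is `t·(ρ·w) = ρ·(t·w)`, which holds because `ρ·t = t`. -/
theorem isSplitting_of_mem_symTensors {n : ℕ} {t : ⨂[K]^n A} (ht : t ∈ symTensors K A n) :
    IsSplitting K M (DirectSum.lof K ℕ (Comp K A) n (sharp K 1 t)) := by
  intro u v
  rw [coprod_sharp_one, map_sum]
  simp only [listTensor, shufMul_lof, map_sum]
  by_cases hn : n = u.length + v.length
  · subst hn
    rw [Finset.sum_eq_single (⟨(u.length, v.length),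
      Finset.HasAntidiagonal.mem_antidiagonal.2 rfl⟩ :
        {pq : ℕ × ℕ // pq ∈ Finset.HasAntidiagonal.antidiagonal (u.length + v.length)})]
    · rw [actShuf_lof_same, mulEquiv_split]
      refine Finset.sum_congr rfl fun ρ _ => ?_
      rw [act_lof_same, actComp, liftComp_sharp, LinearMap.compl₂_apply, permTensor_one,
        ← tensorAct_permTensor, ht ρ]
    · rintro pq _ hne
      exact actShuf_lof_of_ne K (fun h => hne (Subtype.ext h)) _ _ _
    · simp
  · rw [Finset.sum_eq_zero fun ρ _ => act_lof_of_ne K hn _ _, Finset.sum_eq_zero]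
    rintro ⟨pq, hpq⟩ _
    refine actShuf_lof_of_ne K ?_ _ _ _
    intro h
    obtain rfl : pq = (u.length, v.length) := h
    exact hn (Finset.HasAntidiagonal.mem_antidiagonal.1 hpq).symm

end Generators

section Internal

variable (K : Type*) [CommRing K] {A : Type*} [Ring A] [Algebra K A]

/-! ### The splitting formula for two factors -/

theorem intMul_lof_same {n : ℕ} (x y : Comp K A n) :
    intMul K A (DirectSum.lof K ℕ (Comp K A) n x) (DirectSum.lof K ℕ (Comp K A) n y) =
      DirectSum.lof K ℕ (Comp K A) n (intMulComp K n x y) := by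
  simp [intMul, DirectSum.component.lof_self]

theorem intMul_lof_of_ne {n m : ℕ} (h : n ≠ m) (x : Comp K A n) (y : Comp K A m) :
    intMul K A (DirectSum.lof K ℕ (Comp K A) n x) (DirectSum.lof K ℕ (Comp K A) m y) = 0 := by
  rw [intMul, DirectSum.toModule_lof, LinearMap.compl₂_apply, DirectSum.component.of,
    dif_neg h.symm, map_zero]

theorem intMul_pure {n : ℕ} (σ τ : Equiv.Perm (Fin n)) (a b : Fin n → A) :
    intMul K A (pureElem K σ a) (pureElem K τ b) =
      pureElem K (σ * τ) fun i => a i * b (σ⁻¹ i) := by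
  rw [pureElem, pureElem, intMul_lof_same]
  simp [intMulComp, permTensor_tprod, PiTensorProduct.tprod_mul_tprod, pureElem, Pi.mul_def]

/-- The biletter `(a, k)` as an element of the `A`-module of finitely supported functions. -/
def biletter (x : A × ℕ) : ℕ →₀ A := Finsupp.single x.2 x.1

open Classical in
variable (A) in
/-- The linear extension of `wordElem` to the tensors over the `A`-module `ℕ →₀ A`. -/
def standardize : TensorSum K (ℕ →₀ A) →ₗ[K] FQ K A :=
  DirectSum.toModule K ℕ _ fun n => DirectSum.lof K ℕ (Comp K A) n ∘ₗ
    (Finsupp.lsum K fun k : Fin n → ℕ => sharp K (standardization k)⁻¹) ∘ₗ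
    (PiTensorProduct.ofFinsuppEquiv (R := K) (κ := fun _ : Fin n => ℕ)
      (M := fun _ : Fin n => A)).toLinearMap

open Classical in
theorem standardize_listTensor (u : List (A × ℕ)) :
    standardize K A (listTensor K (u.map biletter)) = wordElem K u := by
  obtain ⟨n, f, rfl⟩ : ∃ n, ∃ f : Fin n → A × ℕ, u = List.ofFn f :=
    ⟨_, u.get, (List.ofFn_get u).symm⟩
  rw [List.map_ofFn, listTensor_ofFn, wordElem_ofFn, standardize, DirectSum.toModule_lof]
  simp only [LinearMap.comp_apply, LinearEquiv.coe_coe, Function.comp_def, biletter]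
  rw [PiTensorProduct.ofFinsuppEquiv_tprod_single]
  simp [pureElem]

/-- A pure element of `F(A)` acts on a word with distinct letters by rearranging its biletters. -/
theorem pure_act_word {n : ℕ} (σ : Equiv.Perm (Fin n)) (a : Fin n → A) {u : List (A × ℕ)}
    (hu : (u.map Prod.snd).Nodup) :
    (act K A (ℕ →₀ A) (pureElem K σ a) (listTensor K (u.map biletter)) = 0 ∧
      intMul K A (pureElem K σ a) (wordElem K u) = 0) ∨
    ∃ w : List (A × ℕ), (w.map Prod.snd).Nodup ∧ (∀ x ∈ w, ∃ y ∈ u, y.2 = x.2) ∧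
      act K A (ℕ →₀ A) (pureElem K σ a) (listTensor K (u.map biletter)) =
        listTensor K (w.map biletter) ∧
      intMul K A (pureElem K σ a) (wordElem K u) = wordElem K w := by
  obtain ⟨m, f, rfl⟩ : ∃ n, ∃ f : Fin n → A × ℕ, u = List.ofFn f :=
    ⟨_, u.get, (List.ofFn_get u).symm⟩
  rw [List.map_ofFn, List.nodup_ofFn] at hu
  by_cases h : n = m
  · subst h
    refine Or.inr ⟨List.ofFn fun i => (a i * (f (σ⁻¹ i)).1, (f (σ⁻¹ i)).2), ?_, ?_, ?_, ?_⟩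
    · rw [List.map_ofFn, List.nodup_ofFn]
      exact hu.comp (σ⁻¹).injective
    · simp only [List.mem_ofFn, forall_exists_index, forall_apply_eq_imp_iff]
      exact fun i => ⟨f (σ⁻¹ i), ⟨_, rfl⟩, rfl⟩
    · rw [List.map_ofFn, act_pure_ofFn, List.map_ofFn]
      simp [biletter, Function.comp_def]
    · have h := standardization_comp_perm hu σ⁻¹
      simp only [Function.comp_apply] at h
      rw [wordElem_ofFn, wordElem_ofFn, intMul_pure]
      dsimp only
      rw [h, mul_inv_rev, inv_inv]
      rfl
  · refine Or.inl ⟨?_, ?_⟩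
    · exact act_pure_of_length_ne K σ a _ (by simpa using Ne.symm h)
    · rw [wordElem_ofFn]
      exact intMul_lof_of_ne K h _ _

/-- Both products rearrange the biletters and multiply their first entries by elements of `A`; with
distinct letters, standardization follows the rearrangement. -/
theorem intMul_wordElem (x : FQ K A) {u : List (A × ℕ)} (hu : (u.map Prod.snd).Nodup) :
    intMul K A x (wordElem K u) =
      standardize K A (act K A (ℕ →₀ A) x (listTensor K (u.map biletter))) := by
  refine LinearMap.congr_fun (f := (intMul K A).flip (wordElem K u))
    (g := standardize K A ∘ₗ (act K A (ℕ →₀ A)).flip (listTensor K (u.map biletter)))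
    (hom_ext_pure fun n σ a => ?_) x
  rw [LinearMap.comp_apply, LinearMap.flip_apply, LinearMap.flip_apply]
  obtain ⟨h1, h2⟩ | ⟨w, -, -, h1, h2⟩ := pure_act_word K σ a hu
  · rw [h1, h2, map_zero]
  · rw [h1, h2, standardize_listTensor]

variable (A) in
/-- The internal product of `F(A) ⊗ F(A)`. -/
def intMulTensor : FQ K A ⊗[K] FQ K A →ₗ[K] FQ K A ⊗[K] FQ K A →ₗ[K] FQ K A ⊗[K] FQ K A :=
  TensorProduct.map₂ (intMul K A) (intMul K A)

theorem intMulTensor_tmul (x x' y y' : FQ K A) :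
    intMulTensor K A (x ⊗ₜ x') (y ⊗ₜ y') = intMul K A x y ⊗ₜ intMul K A x' y' := by
  simp [intMulTensor]

/-- The action introduces no new letters into either word. The first alphabet thus stays below the
second, and the external product of the results is still their shuffle. -/
theorem intMulTensor_wordElem (x : FQ K A ⊗[K] FQ K A) {u v : List (A × ℕ)}
    (hu : (u.map Prod.snd).Nodup) (hv : (v.map Prod.snd).Nodup)
    (huv : ∀ x ∈ u, ∀ y ∈ v, x.2 < y.2) :
    TensorProduct.lift (extMul K) (intMulTensor K A x (wordElem K u ⊗ₜ wordElem K v)) =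
      standardize K A (actShuf K (M := ℕ →₀ A) (listTensor K (u.map biletter))
        (listTensor K (v.map biletter)) x) := by
  refine LinearMap.congr_fun (f := TensorProduct.lift (extMul K) ∘ₗ
      (intMulTensor K A).flip (wordElem K u ⊗ₜ wordElem K v))
    (g := standardize K A ∘ₗ actShuf K (M := ℕ →₀ A) (listTensor K (u.map biletter))
        (listTensor K (v.map biletter)))
    (TensorProduct.ext (hom_ext_pure fun n σ a => hom_ext_pure fun m τ b => ?_)) x
  simp only [LinearMap.compr₂ₛₗ_apply, TensorProduct.mk_apply, LinearMap.comp_apply,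
    LinearMap.flip_apply, intMulTensor_tmul, actShuf_tmul, TensorProduct.lift.tmul]
  obtain ⟨h1, h2⟩ | ⟨w, hw, hwu, h1, h2⟩ := pure_act_word K σ a hu
  · simp only [h1, h2, map_zero, LinearMap.zero_apply]
  obtain ⟨h3, h4⟩ | ⟨w', hw', hwv, h3, h4⟩ := pure_act_word K τ b hv
  · simp only [h3, h4, map_zero]
  rw [h1, h2, h3, h4, shufMul_listTensor, shufSum_map, map_shufSum, extMul_wordElem K hw hw']
  · exact shufSum_congr fun w _ => (standardize_listTensor K w).symm
  · intro x hx y hy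
    obtain ⟨x', hx', hxx⟩ := hwu x hx
    obtain ⟨y', hy', hyy⟩ := hwv y hy
    rw [← hxx, ← hyy]
    exact huv x' hx' y' hy'

variable {K} in
-- For words with ordered alphabets, both sides are `standardize` applied to the two sides of the
-- splitting property.
theorem IsSplitting.intMul_extMul {x : FQ K A} (hx : IsSplitting K (ℕ →₀ A) x) (y z : FQ K A) :
    intMul K A x (extMul K y z) =
      TensorProduct.lift (extMul K) (intMulTensor K A (coprod K A x) (y ⊗ₜ z)) := by
  refine LinearMap.congr_fun (f := intMul K A x ∘ₗ (extMul K).flip z)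
    (g := TensorProduct.lift (extMul K) ∘ₗ intMulTensor K A (coprod K A x) ∘ₗ
      (TensorProduct.mk K (FQ K A) (FQ K A)).flip z) (hom_ext_word 0 fun u hu _ => ?_) y
  obtain ⟨c, hc⟩ := exists_forall_lt u
  refine LinearMap.congr_fun (f := intMul K A x ∘ₗ extMul K (wordElem K u))
    (g := TensorProduct.lift (extMul K) ∘ₗ intMulTensor K A (coprod K A x) ∘ₗ
      TensorProduct.mk K (FQ K A) (FQ K A) (wordElem K u)) (hom_ext_word c fun v hv hcv => ?_) z
  have huv : ∀ x ∈ u, ∀ y ∈ v, x.2 < y.2 := fun x hx y hy => (hc x hx).trans_le (hcv y hy)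
  simp only [LinearMap.comp_apply, TensorProduct.mk_apply]
  rw [intMulTensor_wordElem K _ hu hv huv, ← hx, shufMul_listTensor, shufSum_map, map_shufSum,
    map_shufSum, extMul_wordElem K hu hv huv, map_shufSum]
  exact shufSum_congr fun w hw => intMul_wordElem K x (nodup_of_perm_append hu hv huv hw)

end Internal

/-! ### The Novelli-Thibon bialgebra -/

section NovelliThibon

variable {K : Type*} [CommRing K] {V : Type*} [AddCommGroup V] [Module K V]

theorem extMul_mem_NT {x y : FQ K V} (hx : x ∈ NT K V) (hy : y ∈ NT K V) :
    extMul K x y ∈ NT K V := by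
  simp only [NT, Submodule.mem_sInf, Set.mem_ofPred_eq] at hx hy ⊢
  exact fun S hS => hS.2.2 x (hx S hS) y (hy S hS)

theorem lof_sharp_one_mem_NT {n : ℕ} {t : ⨂[K]^n V} (ht : t ∈ symTensors K V n) :
    DirectSum.lof K ℕ (Comp K V) n (sharp K 1 t) ∈ NT K V := by
  simp only [NT, Submodule.mem_sInf, Set.mem_ofPred_eq]
  exact fun S hS => hS.2.1 n t ht

/-- The unit needs no separate check, being the generator `t # e_0` with `t` the empty tensor. -/
theorem NT_le {S : Submodule K (FQ K V)}
    (h : ∀ (n : ℕ), ∀ t ∈ symTensors K V n, DirectSum.lof K ℕ (Comp K V) n (sharp K 1 t) ∈ S)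
    (hmul : ∀ x ∈ S, ∀ y ∈ S, extMul K x y ∈ S) : NT K V ≤ S := by
  refine sInf_le ⟨h 0 _ fun π => ?_, h, hmul⟩
  rw [permTensor_tprod]
  exact congrArg _ (Subsingleton.elim _ _)

instance flat_tensorPower [Module.Flat K V] (n : ℕ) : Module.Flat K (⨂[K]^n V) := by
  induction n with
  | zero => exact Module.Flat.of_linearEquiv (PiTensorProduct.isEmptyEquiv (Fin 0))
  | succ n ih =>
    have : Module.Flat K (⨂[K]^1 V) := Module.Flat.of_linearEquiv
      (PiTensorProduct.subsingletonEquiv (R := K) (s := fun _ : Fin 1 => V) 0)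
    exact Module.Flat.of_linearEquiv
      (TensorPower.mulEquiv (R := K) (M := V) (n := n) (m := 1)).symm

theorem mulEquiv_rTensor_permTensor {p q : ℕ} (π : Equiv.Perm (Fin p))
    (s : (⨂[K]^p V) ⊗[K] (⨂[K]^q V)) :
    TensorPower.mulEquiv ((permTensor K π).rTensor (⨂[K]^q V) s) =
      permTensor K (crossPerm π 1) (TensorPower.mulEquiv s) := by
  refine LinearMap.congr_fun (f := TensorPower.mulEquiv.toLinearMap ∘ₗ
      (permTensor K π).rTensor (⨂[K]^q V))
    (g := permTensor K (crossPerm π 1) ∘ₗ TensorPower.mulEquiv.toLinearMap)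
    (TensorProduct.ext (tensor_hom_ext₂ K fun a b => ?_)) s
  simp only [LinearMap.compr₂ₛₗ_apply, TensorProduct.mk_apply, LinearMap.comp_apply,
    LinearEquiv.coe_coe, LinearMap.rTensor_tmul, permTensor_tprod, mulEquiv_tprod]
  congr 1
  ext i
  rw [crossPerm_inv]
  refine Fin.addCases (fun i => ?_) (fun i => ?_) i
  · simp [crossPerm_castAdd]
  · simp [crossPerm_natAdd]

/-- Over a flat module, splitting a symmetric tensor gives symmetric tensors on the left. -/
theorem split_mem_range [Module.Flat K V] {n p q : ℕ} (h : p + q = n) {t : ⨂[K]^n V}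
    (ht : t ∈ symTensors K V n) :
    split K h t ∈ LinearMap.range ((symTensors K V p).subtype.rTensor (⨂[K]^q V)) := by
  subst h
  let θ : (⨂[K]^p V) →ₗ[K] (Equiv.Perm (Fin p) → ⨂[K]^p V) :=
    LinearMap.pi fun π => permTensor K π - LinearMap.id
  have hexact : Function.Exact (symTensors K V p).subtype θ := by
    rw [LinearMap.exact_iff, Submodule.range_subtype]
    ext s
    simp only [θ, LinearMap.mem_ker, funext_iff, LinearMap.pi_apply, LinearMap.sub_apply,
      LinearMap.id_apply, Pi.zero_apply, sub_eq_zero]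
    rfl
  -- Written as a finite sum, `θ` can be tensored with `V^{⊗ q}` one permutation at a time.
  have hθ : θ = ∑ π, LinearMap.single K (fun _ : Equiv.Perm (Fin p) => ⨂[K]^p V) π ∘ₗ
      (permTensor K π - LinearMap.id) := by
    ext1
    ext f π
    simp [θ, LinearMap.sum_apply, Finset.sum_apply, Pi.single_apply]
  rw [← LinearMap.exact_iff.1 (Module.Flat.rTensor_exact (⨂[K]^q V) hexact), LinearMap.mem_ker,
    hθ, ← LinearMap.coe_rTensorHom, map_sum, LinearMap.sum_apply]
  refine Finset.sum_eq_zero fun π _ => ?_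
  rw [LinearMap.coe_rTensorHom, LinearMap.rTensor_comp, LinearMap.comp_apply,
    LinearMap.rTensor_sub, LinearMap.sub_apply, LinearMap.rTensor_id, LinearMap.id_apply]
  -- Permuting the first `p` places by `π` is the action of `π × 1`, which fixes `t`.
  have : (permTensor K π).rTensor (⨂[K]^q V) (split K rfl t) = split K rfl t := by
    apply TensorPower.mulEquiv.injective
    rw [mulEquiv_rTensor_permTensor, mulEquiv_split, ht]
  rw [this, sub_self, map_zero]

/-- The left factors of the coproduct of an element of `NT(V)` can be chosen in `NT(V)`. -/
theorem coprod_mem_range [Module.Flat K V] {x : FQ K V} (hx : x ∈ NT K V) :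
    coprod K V x ∈ LinearMap.range ((NT K V).subtype.rTensor (FQ K V)) := by
  have hle : NT K V ≤ (LinearMap.range ((NT K V).subtype.rTensor (FQ K V))).comap
      (coprod K V) := by
    refine NT_le (fun n t ht => ?_) fun x hx y hy => ?_
    · rw [Submodule.mem_comap, coprod_sharp_one]
      refine Submodule.sum_mem _ fun pq _ => ?_
      obtain ⟨s, hs⟩ := split_mem_range (Finset.HasAntidiagonal.mem_antidiagonal.1 pq.2) ht
      rw [← hs]
      clear hs
      induction s with
      | zero => simp
      | add s s' h h' => simpa only [map_add] using Submodule.add_mem _ h h'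
      | tmul s s' =>
        exact ⟨⟨_, lof_sharp_one_mem_NT s.2⟩ ⊗ₜ _, rfl⟩
    · rw [Submodule.mem_comap] at hx hy ⊢
      rw [coprod_extMul]
      obtain ⟨s, hs⟩ := hx
      obtain ⟨s', hs'⟩ := hy
      rw [← hs, ← hs']
      clear hs hs'
      induction s with
      | zero => simp
      | add s₁ s₂ h₁ h₂ => simpa using Submodule.add_mem _ h₁ h₂
      | tmul s₁ s₂ =>
        induction s' with
        | zero => simp
        | add s₁ s₂ h₁ h₂ => simpa using Submodule.add_mem _ h₁ h₂
        | tmul s₁' s₂' =>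
          rw [LinearMap.rTensor_tmul, LinearMap.rTensor_tmul, extMulTensor_tmul]
          exact ⟨⟨_, extMul_mem_NT s₁.2 s₁'.2⟩ ⊗ₜ _, rfl⟩
  exact hle hx

theorem isSplitting_of_mem_NT {A : Type*} [Ring A] [Algebra K A] {M : Type*} [AddCommGroup M]
    [Module K M] [Module A M] [IsScalarTower K A M] {x : FQ K A} (hx : x ∈ NT K A) :
    IsSplitting K M x := by
  let S : Submodule K (FQ K A) :=
    { carrier := {x | IsSplitting K M x}
      add_mem' := fun hx hy u v => by
        rw [map_add, LinearMap.add_apply, map_add, map_add, hx, hy]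
      zero_mem' := fun u v => by rw [map_zero, LinearMap.zero_apply, map_zero, map_zero]
      smul_mem' := fun c x hx u v => by
        rw [map_smul, LinearMap.smul_apply, map_smul, map_smul, hx] }
  exact NT_le (S := S) (fun n t ht => isSplitting_of_mem_symTensors K ht)
    (fun x hx y hy => IsSplitting.mul hx hy) hx

end NovelliThibon

/-! ### The splitting formula -/

section Splitting

theorem extProd_succ (K : Type*) [CommRing K] {V : Type*} [AddCommGroup V] [Module K V] {l : ℕ}
    (z : Fin (l + 1) → FQ K V) :
    extProd K V (l + 1) z = extMul K (z 0) (extProd K V l fun i => z i.succ) :=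
  rfl

/-- `extProd` is built from the left, whereas `iterCoprod` separates the last factor; associativity
reconciles them. -/
theorem extProd_succ_last (K : Type*) [CommRing K] {V : Type*} [AddCommGroup V] [Module K V]
    {l : ℕ} (z : Fin (l + 1) → FQ K V) :
    extProd K V (l + 1) z =
      extMul K (extProd K V l fun i => z i.castSucc) (z (Fin.last l)) := by
  induction l with
  | zero =>
    rw [extProd_succ]
    exact (extMul_unit K _).trans (unit_extMul K _).symm
  | succ l ih =>
    rw [extProd_succ, ih, extProd_succ, extMul_assoc]
    rfl

variable (K : Type*) [CommRing K] {A : Type*} [Ring A] [Algebra K A]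

theorem splitMap_tprod {l : ℕ} (z g : Fin l → FQ K A) :
    splitMap K z (PiTensorProduct.tprod K g) =
      extProd K A l fun i => intMul K A (g i) (z i) := by
  simp [splitMap]

theorem splitMap_mulEquiv {l : ℕ} (z : Fin (l + 1) → FQ K A) (t : ⨂[K]^l (FQ K A))
    (x : FQ K A) :
    splitMap K z (TensorPower.mulEquiv (t ⊗ₜ[K]
        (PiTensorProduct.subsingletonEquiv (R := K) (s := fun _ : Fin 1 => FQ K A) 0).symm x)) =
      extMul K (splitMap K (fun i => z i.castSucc) t) (intMul K A x (z (Fin.last l))) := by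
  rw [PiTensorProduct.subsingletonEquiv_symm_apply']
  refine LinearMap.congr_fun (f := splitMap K z ∘ₗ TensorPower.mulEquiv.toLinearMap ∘ₗ
      (TensorProduct.mk K (⨂[K]^l (FQ K A)) (⨂[K]^1 (FQ K A))).flip
        (PiTensorProduct.tprod K fun _ => x))
    (g := (extMul K).flip (intMul K A x (z (Fin.last l))) ∘ₗ
      splitMap K fun i => z i.castSucc)
    (PiTensorProduct.ext (MultilinearMap.ext fun g => ?_)) t
  simp only [LinearMap.compMultilinearMap_apply, LinearMap.comp_apply, LinearMap.flip_apply,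
    TensorProduct.mk_apply, LinearEquiv.coe_coe, splitMap_tprod]
  have h : TensorPower.mulEquiv (PiTensorProduct.tprod K g ⊗ₜ[K]
      PiTensorProduct.tprod K fun _ : Fin 1 => x) = PiTensorProduct.tprod K (Fin.append g _) :=
    TensorPower.tprod_mul_tprod K g fun _ => x
  rw [h, splitMap_tprod, extProd_succ_last]
  have h₁ (i : Fin l) : Fin.append g (fun _ : Fin 1 => x) i.castSucc = g i :=
    Fin.append_left g (fun _ : Fin 1 => x) i
  have h₂ : Fin.append g (fun _ : Fin 1 => x) (Fin.last l) = x :=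
    Fin.append_right g (fun _ : Fin 1 => x) 0
  simp only [h₁, h₂]

theorem intMul_unit (y : FQ K A) : intMul K A y (unit K A) = counit K A y • unit K A := by
  refine LinearMap.congr_fun (f := (intMul K A).flip (unit K A))
    (g := (counit K A).smulRight (unit K A)) (hom_ext_pure fun n σ a => ?_) y
  rw [LinearMap.flip_apply, LinearMap.smulRight_apply]
  rcases n with _ | n
  · have h : counit K A (pureElem K σ a) = 1 := by
      rw [counit, LinearMap.comp_apply, pureElem, DirectSum.component.lof_self, liftComp_sharp,
        LinearEquiv.coe_coe, PiTensorProduct.isEmptyEquiv_apply_tprod]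
    rw [h, one_smul]
    refine (intMul_pure K σ 1 a _).trans ?_
    exact congrArg₂ (pureElem K) (Subsingleton.elim _ _) (Subsingleton.elim _ _)
  · have h : counit K A (pureElem K σ a) = 0 := by
      rw [counit, LinearMap.comp_apply, pureElem, DirectSum.component.of, dif_neg (by simp),
        map_zero]
    rw [h, zero_smul]
    exact intMul_lof_of_ne K (Nat.succ_ne_zero n) _ _

theorem intMul_extProd_succ [Module.Flat K A] (l : ℕ) (y : FQ K A) (hy : y ∈ NT K A)
    (z : Fin (l + 1) → FQ K A) :
    intMul K A y (extProd K A (l + 1) z) = splitMap K z (iterCoprod K A (l + 1) y) := by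
  induction l generalizing y with
  | zero =>
    rw [iterCoprod, LinearEquiv.coe_coe, PiTensorProduct.subsingletonEquiv_symm_apply',
      splitMap_tprod, extProd_succ, extProd_succ]
    exact (congrArg _ (extMul_unit K _)).trans (extMul_unit K _).symm
  | succ l ih =>
    rw [extProd_succ_last, (isSplitting_of_mem_NT hy).intMul_extMul, iterCoprod]
    simp only [LinearMap.comp_apply, LinearEquiv.coe_coe]
    -- The induction hypothesis concerns elements of `NT(A)`, so `Δ(y)` is written with left factors
    -- there. Flatness enters here.
    obtain ⟨s, hs⟩ := coprod_mem_range hy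
    rw [← hs]
    clear hs
    induction s with
    | zero => simp
    | add s s' h h' => simp only [map_add, LinearMap.add_apply, h, h']
    | tmul y₁ y₂ =>
      rw [LinearMap.rTensor_tmul, intMulTensor_tmul, TensorProduct.lift.tmul,
        TensorProduct.map_tmul, LinearEquiv.coe_coe, splitMap_mulEquiv]
      exact congrArg (fun x => extMul K x _) (ih _ y₁.2 _)

end Splitting

end FreeQuasiSym

end


theorem mainTheorem4 {K : Type*} [CommRing K] {A : Type*} [Ring A] [Algebra K A]
    [Module.Projective K A] (y : FreeQuasiSym.FQ K A) (hy : y ∈ FreeQuasiSym.NT K A)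
    (l : ℕ) (z : Fin l → FreeQuasiSym.FQ K A) :
    FreeQuasiSym.intMul K A y (FreeQuasiSym.extProd K A l z) =
      FreeQuasiSym.splitMap K z (FreeQuasiSym.iterCoprod K A l y) := by
  cases l with
  | zero =>
    refine (FreeQuasiSym.intMul_unit K y).trans ?_
    rw [FreeQuasiSym.iterCoprod, LinearMap.comp_apply, LinearEquiv.coe_coe,
      PiTensorProduct.isEmptyEquiv_symm_apply, map_smul, FreeQuasiSym.splitMap_tprod]
    rfl
  -- Projectivity enters only through flatness.
  | succ l => exact FreeQuasiSym.intMul_extProd_succ K l y hy z
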